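/- **Data.** Let $N\ge 1$ be the number of customers, $[n]=\{1,\dots,n\}$, and let node $0$ be the depot. Let $L\ge 0$ and let $c^{w}_j,c^{u}_j$ ($j\in[N]$), $c^{o}$, $\lambda$ be non-negative costs with $c^{u}_{j+1}\le c^{u}_j+c^{w}_j$ for $j\in[N-1]$. Let $0\le\underline d_i\le\mu^{d}_i\le\overline d_i$ for $i\in[N]$ and $0\le\underline t_{p,q}\le\mu^{t}_{p,q}\le\overline t_{p,q}$ for nodes $p\ne q$ in $\{0,\dots,N\}$. Put $\Delta d_i=\overline d_i-\underline d_i$ and $\Delta t_{p,q}=\overline t_{p,q}-\underline t_{p,q}$. **M-DHRAS.** Let $\mathcal X$ be the set of $x\in\{0,1\}^{N\times N}$ with $\sum_i x_{i,j}=1$ for all $j$ and $\sum_j x_{i,j}=1$ for all $i$, and $\mathcal A=\{a\in\mathbb R^N: 0\le a_j\le L,\ a_{j-1}\le a_j\}$, with the conventions $x_{i,N+1}=0$, $a_{N+1}=L$. For $\xi=(d,t)$, $d\in\mathbb R^N$, $t=(t_{p,q})_{p\neq q}$, let $f(x,a,\xi)$ be the minimum of $\sum_{j=1}^N(c^w_jw_j+c^u_ju_j)+c^ow_{N+1}+\lambda\big[\sum_{j=2}^N\sum_{i}\sum_{i'\ne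 i}t_{i,i'}x_{i,j-1}x_{i',j}+\sum_i(t_{0,i}x_{i,1}+t_{i,0}x_{i,N})\big]$ over $u,w\in\mathbb R^{N+1}_{\ge0}$ subject to $w_1-u_1=\sum_it_{0,i}x_{i,1}-a_1$; $w_j-w_{j-1}-u_j=a_{j-1}-a_j+\sum_id_ix_{i,j-1}+\sum_i\sum_{i'\ne i}t_{i,i'}x_{i,j-1}x_{i',j}$ for $2\le j\le N$; $w_{N+1}-w_N-u_{N+1}=a_N-a_{N+1}+\sum_id_ix_{i,N}$. Let $\mathcal S=\{(d,t)\ge 0:\underline d\le d\le\overline d,\ \underline t\le t\le\overline t\}$ and let $\mathcal F$ be the set of probability distributions supported on $\mathcal S$ with mean $(\mu^d,\mu^t)$. M-DHRAS is $$\min_{x\in\mathcal X,\,a\in\mathcal A}\ \sup_{\mathbb P\in\mathcal F}\mathbb E_{\mathbb P}[f(x,a,\xi)].$$ **The MILP.** Set $c^w_{N+1}=c^o$, $c^w_{N+2}=0$, $c^u_{N+1}=c^u_{N+2}=0$ and $\pi_{j,v}=-c^u_v+\sum_{l=j}^{v-1}c^w_l$ for $1\le j\le v\le N+2$. The variables are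 $x,a$ as above and real variables $\alpha_{p,q}$, $\rho_i$, $\beta_j$, $\gamma_{0,i,1,v}$, $\gamma_{i,i',j,v}$, $\delta_{i,j,v}$, $\tau_{i,i',j-1,j}$, $\eta_{i,i',j-1,j}$, $\psi_{0,i}$, $\phi_{i,i',j,v}$, $\sigma_{0,i,1,v}$, $\xi_{i,j,v}$, $\zeta_{i,j}$. For $1\le v\le N+2$ and $2\le k\le N+1$ write $$S_v=-a_1\pi_{1,v}+\sum_i\big[\underline t_{0,i}(\pi_{1,v}x_{i,1}+\lambda x_{i,1}-\psi_{0,i})+\Delta t_{0,i}\sigma_{0,i,1,v}\big],$$ $$T_{k,v}=\sum_{j=k}^{\min(v,N+1)}\Big\{(a_{j-1}-a_j)\pi_{j,v}+\sum_i\sum_{i'\ne i}\big[\underline t_{i,i'}(\pi_{j,v}\tau_{i,i',j-1,j}+\lambda\tau_{i,i',j-1,j}-\eta_{i,i',j-1,j})+\Delta t_{i,i'}\phi_{i,i',j,v}\big]+\sum_i\big[\underline d_i(\pi_{j,v}x_{i,j-1}-\zeta_{i,j})+\Delta d_i\xi_{i,j,v}\big]\Big\}.$$ Minimise $$\sum_i\mu^d_i\rho_i+\sum_{j=2}^N\sum_i\sum_{i'\ne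 i}\mu^t_{i,i'}\eta_{i,i',j-1,j}+\lambda\sum_i\mu^t_{i,0}x_{i,N}+\sum_i\mu^t_{0,i}\psi_{0,i}+\sum_{j=1}^{N+2}\beta_j$$ subject to $x\in\mathcal X$, $a\in\mathcal A$; $\beta_1\ge S_1$; $\sum_{j=1}^v\beta_j\ge S_v+T_{2,v}$ for $2\le v\le N+2$; $\sum_{j=k}^v\beta_j\ge T_{k,v}$ for $2\le k\le N+1$, $k\le v\le N+2$; $\beta_{N+2}\ge0$; and, for all $i\neq i'$ in $[N]$, $2\le j\le N+1$, $j\le v\le N+2$ (and $1\le v\le N+2$ where only $v$ occurs), * $\gamma_{0,i,1,v}\ge\max\{0,\pi_{1,v}+\lambda-\alpha_{0,i}\}$, $\gamma_{i,i',j,v}\ge\max\{0,\pi_{j,v}+\lambda-\alpha_{i,i'}\}$, $\delta_{i,j,v}\ge\max\{0,\pi_{j,v}-\rho_i\}$ (each being two linear inequalities); * the four McCormick inequalities $\underline y\,b\le m\le\overline y\,b$, $y+\overline y(b-1)\le m\le y+\underline y(b-1)$ for each of the products $m=y\cdot b$ in the list $\eta_{i,i',j-1,j}=\alpha_{i,i'}\tau_{i,i',j-1,j}$,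 $\psi_{0,i}=\alpha_{0,i}x_{i,1}$, $\phi_{i,i',j,v}=\gamma_{i,i',j,v}\tau_{i,i',j-1,j}$, $\sigma_{0,i,1,v}=\gamma_{0,i,1,v}x_{i,1}$, $\xi_{i,j,v}=\delta_{i,j,v}x_{i,j-1}$, $\zeta_{i,j}=\rho_ix_{i,j-1}$, and $\max\{0,x_{i,j-1}+x_{i',j}-1\}\le\tau_{i,i',j-1,j}\le\min\{x_{i,j-1},x_{i',j}\}$. The lower bounds of $\gamma,\delta$ are $0$. With $P_1^u,P_1^l$ the maximum and minimum of $\pi_{j,v}$ over $2\le j\le N+1$, $j\le v\le N+2$ and $P_2^u,P_2^l$ those of $\pi_{1,v}$ over $1\le v\le N+2$, the other bounds are $\underline\rho_i=P_1^l$, $\overline\rho_i=P_1^u$, $\underline\alpha_{i,i'}=P_1^l-\lambda$, $\overline\alpha_{i,i'}=P_1^u+\lambda$, $\underline\alpha_{0,i}=P_2^l-\lambda$, $\overline\alpha_{0,i}=P_2^u+\lambda$, $\overline\delta_{i,j,v}=\pi_{j,v}-P_1^l$, $\overline\gamma_{i,i',j,v}=\pi_{j,v}+2\lambda-P_1^l$,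 $\overline\gamma_{0,i,1,v}=\pi_{1,v}+2\lambda-P_2^l$, or any wider bounds (smaller lower, larger upper bounds for $\alpha,\rho$; larger upper bounds for $\gamma,\delta$). **Theorem.** The program above is a mixed-integer linear program (finitely many variables, binary variables $x_{i,j}$, linear objective, finitely many linear constraints), and it is equivalent to M-DHRAS: in M-DHRAS the second-stage minima are attained for $\xi\in\mathcal S$, the expectations exist and the suprema over $\mathcal F\ne\emptyset$ are finite; for every $(x,a)\in\mathcal X\times\mathcal A$, the minimum of the MILP over its remaining variables is attained and equals $\sup_{\mathbb P\in\mathcal F}\mathbb E_{\mathbb P}[f(x,a,\xi)]$; consequently both problems attain their minima, their optimal values coincide, and $(x,a)$ is optimal for M-DHRAS if and only if it is the $(x,a)$-part of an optimal solution of the MILP. -/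

import Mathlib

open MeasureTheory Finset

noncomputable section

namespace DHRAS

/-! ### Problem data

Customers are `i : Fin N`.  Nodes are `Fin (N + 1)`: the depot is `0` and customer `i` is the node
`i.succ`.  Positions in the route are natural numbers counted from `1`; position-indexed families
are functions on `ℕ` of which only the positions explicitly named are ever used. -/

/-- The parameters of the routing and appointment scheduling problem with `N` customers. -/
structure Data (N : ℕ) where
  /-- standard work time -/
  L : ℝ
  /-- unit waiting cost at positions `1, …, N` -/
  cw : ℕ → ℝ
  /-- unit idling cost at positions `1, …, N` -/
  cu : ℕ → ℝ
  /-- unit overtime cost -/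
  co : ℝ
  /-- unit travel time cost -/
  lam : ℝ
  /-- lower bound, upper bound and mean of the service times -/
  dlo : Fin N → ℝ
  dhi : Fin N → ℝ
  meanD : Fin N → ℝ
  /-- lower bound, upper bound and mean of the travel times (the diagonal is never used) -/
  tlo : Fin (N + 1) → Fin (N + 1) → ℝ
  thi : Fin (N + 1) → Fin (N + 1) → ℝ
  meanT : Fin (N + 1) → Fin (N + 1) → ℝ

/-- Ordered pairs of distinct nodes. -/
abbrev Arc (N : ℕ) : Type := {p : Fin (N + 1) × Fin (N + 1) // p.1 ≠ p.2}

/-- Realisations `ξ = (d, t)` of service times and travel times. -/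
abbrev Scenario (N : ℕ) : Type := (Fin N → ℝ) × (Arc N → ℝ)

/-- The travel time `t_{p,q}` between distinct nodes (`0` on the diagonal, which is never used). -/
def Scenario.travel {N : ℕ} (s : Scenario N) (p q : Fin (N + 1)) : ℝ :=
  if h : p ≠ q then s.2 ⟨(p, q), h⟩ else 0

variable {N : ℕ}

/-! ### First stage -/

/-- The feasible routes: `x i j = 1` if customer `i` is served at position `j ∈ [1, N]`,
with the convention `x i (N + 1) = 0`. -/
def routes (N : ℕ) : Set (Fin N → ℕ → ℝ) :=
  {x | (∀ j ∈ Icc 1 N, ∑ i, x i j = 1) ∧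
    (∀ i, ∑ j ∈ Icc 1 N, x i j = 1) ∧
    (∀ i, ∀ j ∈ Icc 1 N, x i j = 0 ∨ x i j = 1) ∧
    ∀ i, x i (N + 1) = 0}

/-- The feasible schedules, with the convention `a (N + 1) = L`. -/
def schedules (D : Data N) : Set (ℕ → ℝ) :=
  {a | (∀ j ∈ Icc 1 N, 0 ≤ a j ∧ a j ≤ D.L) ∧
    (∀ j ∈ Icc 2 N, a (j - 1) ≤ a j) ∧
    a (N + 1) = D.L}

/-! ### Second stage -/

/-- The total travel time along the route `x`. -/
def travelTime (x : Fin N → ℕ → ℝ) (s : Scenario N) : ℝ :=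
  (∑ j ∈ Icc 2 N, ∑ i, ∑ i' ∈ univ.erase i,
      s.travel i.succ i'.succ * x i (j - 1) * x i' j)
    + ∑ i, (s.travel 0 i.succ * x i 1 + s.travel i.succ 0 * x i N)

/-- The constraints of the second-stage linear program in the idling times `u` and the waiting
times `w` (`w (N + 1)` is the overtime). -/
structure RecourseFeasible (x : Fin N → ℕ → ℝ) (a : ℕ → ℝ) (s : Scenario N)
    (u w : ℕ → ℝ) : Prop where
  first : w 1 - u 1 = (∑ i, s.travel 0 i.succ * x i 1) - a 1
  middle : ∀ j ∈ Icc 2 N, w j - w (j - 1) - u j =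
    a (j - 1) - a j + (∑ i, s.1 i * x i (j - 1))
      + ∑ i, ∑ i' ∈ univ.erase i, s.travel i.succ i'.succ * x i (j - 1) * x i' j
  last : w (N + 1) - w N - u (N + 1) = a N - a (N + 1) + ∑ i, s.1 i * x i N
  nonneg : ∀ j ∈ Icc 1 (N + 1), 0 ≤ w j ∧ 0 ≤ u j

/-- The set of objective values of the second-stage linear program. -/
def recourseValues (D : Data N) (x : Fin N → ℕ → ℝ) (a : ℕ → ℝ) (s : Scenario N) : Set ℝ :=
  {r | ∃ u w : ℕ → ℝ, RecourseFeasible x a s u w ∧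
    r = (∑ j ∈ Icc 1 N, (D.cw j * w j + D.cu j * u j)) + D.co * w (N + 1)
      + D.lam * travelTime x s}

/-- The second-stage cost `f(x, a, ξ)`. -/
def recourse (D : Data N) (x : Fin N → ℕ → ℝ) (a : ℕ → ℝ) (s : Scenario N) : ℝ :=
  sInf (recourseValues D x a s)

/-! ### The distributionally robust model -/

/-- The support of `ξ`. -/
def support (D : Data N) : Set (Scenario N) :=
  {s | (∀ i, 0 ≤ s.1 i ∧ D.dlo i ≤ s.1 i ∧ s.1 i ≤ D.dhi i) ∧
    ∀ e : Arc N, 0 ≤ s.2 e ∧ D.tlo e.1.1 e.1.2 ≤ s.2 e ∧ s.2 e ≤ D.thi e.1.1 e.1.2}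

/-- The mean-support ambiguity set: all probability distributions supported on `support D`
with the prescribed means. -/
def ambiguitySet (D : Data N) : Set (Measure (Scenario N)) :=
  {P | IsProbabilityMeasure P ∧ (∀ᵐ s ∂P, s ∈ support D) ∧
    (∀ i, ∫ s, s.1 i ∂P = D.meanD i) ∧
    ∀ e : Arc N, ∫ s, s.2 e ∂P = D.meanT e.1.1 e.1.2}

/-- The expected costs of `(x, a)` under the distributions of the ambiguity set. -/
def expectedCosts (D : Data N) (x : Fin N → ℕ → ℝ) (a : ℕ → ℝ) : Set ℝ :=
  (fun P : Measure (Scenario N) => ∫ s, recourse D x a s ∂P) '' ambiguitySet D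

/-- The worst-case expected cost of `(x, a)`: the objective of M-DHRAS. -/
def worstCase (D : Data N) (x : Fin N → ℕ → ℝ) (a : ℕ → ℝ) : ℝ :=
  sSup (expectedCosts D x a)

/-- `(x, a)` is an optimal solution of M-DHRAS. -/
def IsOptimalDRO (D : Data N) (x : Fin N → ℕ → ℝ) (a : ℕ → ℝ) : Prop :=
  x ∈ routes N ∧ a ∈ schedules D ∧
    ∀ x' ∈ routes N, ∀ a' ∈ schedules D, worstCase D x a ≤ worstCase D x' a'

/-! ### Mixed-integer linear programs -/

/-- The problem of minimising `obj` over `feas`, in variables with names in `V`, is a mixed-integer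
linear program with binary variables `bin`: `obj` is a linear form, `bin` is finite, and `feas` is
cut out by the binary conditions on `bin` and finitely many linear inequalities. The coefficient
vectors are finitely supported, so only finitely many variables occur. -/
def IsMILP {V : Type} (bin : Set V) (obj : (V → ℝ) → ℝ) (feas : Set (V → ℝ)) : Prop :=
  bin.Finite ∧
  (∃ c : V →₀ ℝ, ∀ z, obj z = c.sum fun v r => r * z v) ∧
  ∃ C : Set ((V →₀ ℝ) × ℝ), C.Finite ∧
    feas = {z | (∀ v ∈ bin, z v = 0 ∨ z v = 1) ∧
      ∀ p ∈ C, (p.1.sum fun v r => r * z v) ≤ p.2}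

/-! ### The mixed-integer linear program -/

/-- The names of the variables. In `tau i i' j` and `eta i i' j` the index `j` stands for the pair
of consecutive positions `j - 1, j`; `gamma0 i v`, `sigma i v` and `psi i` are `γ_{0,i,1,v}`,
`σ_{0,i,1,v}` and `ψ_{0,i}`. -/
inductive Var (N : ℕ) : Type
  | x (i : Fin N) (j : ℕ)
  | a (j : ℕ)
  | alpha (p q : Fin (N + 1))
  | rho (i : Fin N)
  | beta (j : ℕ)
  | gamma0 (i : Fin N) (v : ℕ)
  | gamma (i i' : Fin N) (j v : ℕ)
  | delta (i : Fin N) (j v : ℕ)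
  | tau (i i' : Fin N) (j : ℕ)
  | eta (i i' : Fin N) (j : ℕ)
  | psi (i : Fin N)
  | phi (i i' : Fin N) (j v : ℕ)
  | sigma (i : Fin N) (v : ℕ)
  | xi (i : Fin N) (j v : ℕ)
  | zeta (i : Fin N) (j : ℕ)

/-- The binary variables `x_{i,j}`, `i, j ∈ [N]`. -/
def binaryVars (N : ℕ) : Set (Var N) :=
  {v | ∃ i, ∃ j ∈ Icc 1 N, v = Var.x i j}

/-- Waiting costs extended by `c^w_{N+1} = c^o` and `c^w_{N+2} = 0`. -/
def Data.cwExt (D : Data N) (j : ℕ) : ℝ :=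
  if j ≤ N then D.cw j else if j = N + 1 then D.co else 0

/-- Idling costs extended by `c^u_{N+1} = c^u_{N+2} = 0`. -/
def Data.cuExt (D : Data N) (j : ℕ) : ℝ :=
  if j ≤ N then D.cu j else 0

/-- `π_{j,v} = -c^u_v + ∑_{l=j}^{v-1} c^w_l`, for `1 ≤ j ≤ v ≤ N + 2`. -/
def Data.pi (D : Data N) (j v : ℕ) : ℝ :=
  -D.cuExt v + ∑ l ∈ Ico j v, D.cwExt l

/-- `Δd_i`. -/
def Data.deltaD (D : Data N) (i : Fin N) : ℝ := D.dhi i - D.dlo i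

/-- `Δt_{p,q}`. -/
def Data.deltaT (D : Data N) (p q : Fin (N + 1)) : ℝ := D.thi p q - D.tlo p q

/-- The values `π_{j,v}` with `j ∈ [2, N+1]` and `v ∈ [j, N+2]`. -/
def Data.piValues1 (D : Data N) : Set ℝ :=
  {r | ∃ j ∈ Icc 2 (N + 1), ∃ v ∈ Icc j (N + 2), r = D.pi j v}

/-- The values `π_{1,v}` with `v ∈ [1, N+2]`. -/
def Data.piValues2 (D : Data N) : Set ℝ :=
  {r | ∃ v ∈ Icc 1 (N + 2), r = D.pi 1 v}

/-- Maxima and minima of the two finite sets above. -/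
def Data.P1u (D : Data N) : ℝ := sSup D.piValues1
def Data.P1l (D : Data N) : ℝ := sInf D.piValues1
def Data.P2u (D : Data N) : ℝ := sSup D.piValues2
def Data.P2l (D : Data N) : ℝ := sInf D.piValues2

/-- Variable bounds for the McCormick inequalities. The lower bounds of `γ` and `δ` are `0`. -/
structure Bounds (N : ℕ) where
  alphaLo : Fin (N + 1) → Fin (N + 1) → ℝ
  alphaHi : Fin (N + 1) → Fin (N + 1) → ℝ
  rhoLo : Fin N → ℝ
  rhoHi : Fin N → ℝ
  gamma0Hi : Fin N → ℕ → ℝ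
  gammaHi : Fin N → Fin N → ℕ → ℕ → ℝ
  deltaHi : Fin N → ℕ → ℕ → ℝ

/-- The tight explicit bounds. -/
def tightBounds (D : Data N) : Bounds N where
  alphaLo p _ := if p = 0 then D.P2l - D.lam else D.P1l - D.lam
  alphaHi p _ := if p = 0 then D.P2u + D.lam else D.P1u + D.lam
  rhoLo _ := D.P1l
  rhoHi _ := D.P1u
  gamma0Hi _ v := D.pi 1 v + 2 * D.lam - D.P2l
  gammaHi _ _ j v := D.pi j v + 2 * D.lam - D.P1l
  deltaHi _ j v := D.pi j v - D.P1l

/-- The bounds `B'` are at least as wide as the bounds `B`. -/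
structure Bounds.Wider (B' B : Bounds N) : Prop where
  alphaLo : ∀ p q, B'.alphaLo p q ≤ B.alphaLo p q
  alphaHi : ∀ p q, B.alphaHi p q ≤ B'.alphaHi p q
  rhoLo : ∀ i, B'.rhoLo i ≤ B.rhoLo i
  rhoHi : ∀ i, B.rhoHi i ≤ B'.rhoHi i
  gamma0Hi : ∀ i v, B.gamma0Hi i v ≤ B'.gamma0Hi i v
  gammaHi : ∀ i i' j v, B.gammaHi i i' j v ≤ B'.gammaHi i i' j v
  deltaHi : ∀ i j v, B.deltaHi i j v ≤ B'.deltaHi i j v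

/-- The objective function of the program. -/
def milpObj (D : Data N) (z : Var N → ℝ) : ℝ :=
  (∑ i, D.meanD i * z (.rho i))
    + (∑ j ∈ Icc 2 N, ∑ i, ∑ i' ∈ univ.erase i, D.meanT i.succ i'.succ * z (.eta i i' j))
    + D.lam * (∑ i, D.meanT i.succ 0 * z (.x i N))
    + (∑ i, D.meanT 0 i.succ * z (.psi i))
    + ∑ j ∈ Icc 1 (N + 2), z (.beta j)

/-- The terms of the `β`-constraints that belong to position `1`. -/
def startTerm (D : Data N) (z : Var N → ℝ) (v : ℕ) : ℝ :=
  -(z (.a 1) * D.pi 1 v)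
    + ∑ i, (D.tlo 0 i.succ * (D.pi 1 v * z (.x i 1) + D.lam * z (.x i 1) - z (.psi i))
        + D.deltaT 0 i.succ * z (.sigma i v))

/-- The terms of the `β`-constraints that belong to the positions `k, …, min (v, N + 1)`,
for `2 ≤ k`. -/
def blockTerm (D : Data N) (z : Var N → ℝ) (k v : ℕ) : ℝ :=
  (∑ j ∈ Icc k (min v (N + 1)), (z (.a (j - 1)) - z (.a j)) * D.pi j v)
    + (∑ j ∈ Icc k (min v (N + 1)), ∑ i, ∑ i' ∈ univ.erase i,
        (D.tlo i.succ i'.succ *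
            (D.pi j v * z (.tau i i' j) + D.lam * z (.tau i i' j) - z (.eta i i' j))
          + D.deltaT i.succ i'.succ * z (.phi i i' j v)))
    + ∑ j ∈ Icc k (min v (N + 1)), ∑ i,
        (D.dlo i * (D.pi j v * z (.x i (j - 1)) - z (.zeta i j))
          + D.deltaD i * z (.xi i j v))

/-- The constraints of the mixed-integer linear program. -/
structure MILPFeasible (D : Data N) (B : Bounds N) (z : Var N → ℝ) : Prop where
  route : (fun i j => z (.x i j)) ∈ routes N
  schedule : (fun j => z (.a j)) ∈ schedules D
  beta_first : startTerm D z 1 ≤ z (.beta 1)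
  beta_start : ∀ v ∈ Icc 2 (N + 2),
    startTerm D z v + blockTerm D z 2 v ≤ ∑ j ∈ Icc 1 v, z (.beta j)
  beta_block : ∀ k ∈ Icc 2 (N + 1), ∀ v ∈ Icc k (N + 2),
    blockTerm D z k v ≤ ∑ j ∈ Icc k v, z (.beta j)
  beta_last : 0 ≤ z (.beta (N + 2))
  gamma0_ge : ∀ i, ∀ v ∈ Icc 1 (N + 2), 0 ≤ z (.gamma0 i v) ∧
    D.pi 1 v + D.lam - z (.alpha 0 i.succ) ≤ z (.gamma0 i v)
  gamma_ge : ∀ i, ∀ i' ∈ univ.erase i, ∀ j ∈ Icc 2 (N + 1), ∀ v ∈ Icc j (N + 2),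
    0 ≤ z (.gamma i i' j v) ∧
    D.pi j v + D.lam - z (.alpha i.succ i'.succ) ≤ z (.gamma i i' j v)
  delta_ge : ∀ i, ∀ j ∈ Icc 2 (N + 1), ∀ v ∈ Icc j (N + 2),
    0 ≤ z (.delta i j v) ∧ D.pi j v - z (.rho i) ≤ z (.delta i j v)
  mc_tau : ∀ i, ∀ i' ∈ univ.erase i, ∀ j ∈ Icc 2 (N + 1),
    z (.x i (j - 1)) + z (.x i' j) - 1 ≤ z (.tau i i' j) ∧ 0 ≤ z (.tau i i' j) ∧
    z (.tau i i' j) ≤ z (.x i (j - 1)) ∧ z (.tau i i' j) ≤ z (.x i' j)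
  mc_eta : ∀ i, ∀ i' ∈ univ.erase i, ∀ j ∈ Icc 2 (N + 1),
    B.alphaLo i.succ i'.succ * z (.tau i i' j) ≤ z (.eta i i' j) ∧
    z (.alpha i.succ i'.succ) + B.alphaHi i.succ i'.succ * (z (.tau i i' j) - 1)
      ≤ z (.eta i i' j) ∧
    z (.eta i i' j) ≤ B.alphaHi i.succ i'.succ * z (.tau i i' j) ∧
    z (.eta i i' j)
      ≤ z (.alpha i.succ i'.succ) + B.alphaLo i.succ i'.succ * (z (.tau i i' j) - 1)
  mc_psi : ∀ i,
    B.alphaLo 0 i.succ * z (.x i 1) ≤ z (.psi i) ∧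
    z (.alpha 0 i.succ) + B.alphaHi 0 i.succ * (z (.x i 1) - 1) ≤ z (.psi i) ∧
    z (.psi i) ≤ B.alphaHi 0 i.succ * z (.x i 1) ∧
    z (.psi i) ≤ z (.alpha 0 i.succ) + B.alphaLo 0 i.succ * (z (.x i 1) - 1)
  mc_phi : ∀ i, ∀ i' ∈ univ.erase i, ∀ j ∈ Icc 2 (N + 1), ∀ v ∈ Icc j (N + 2),
    z (.gamma i i' j v) + B.gammaHi i i' j v * (z (.tau i i' j) - 1) ≤ z (.phi i i' j v) ∧
    0 ≤ z (.phi i i' j v) ∧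
    z (.phi i i' j v) ≤ B.gammaHi i i' j v * z (.tau i i' j) ∧
    z (.phi i i' j v) ≤ z (.gamma i i' j v)
  mc_sigma : ∀ i, ∀ v ∈ Icc 1 (N + 2),
    z (.gamma0 i v) + B.gamma0Hi i v * (z (.x i 1) - 1) ≤ z (.sigma i v) ∧
    0 ≤ z (.sigma i v) ∧
    z (.sigma i v) ≤ B.gamma0Hi i v * z (.x i 1) ∧
    z (.sigma i v) ≤ z (.gamma0 i v)
  mc_xi : ∀ i, ∀ j ∈ Icc 2 (N + 1), ∀ v ∈ Icc j (N + 2),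
    z (.delta i j v) + B.deltaHi i j v * (z (.x i (j - 1)) - 1) ≤ z (.xi i j v) ∧
    0 ≤ z (.xi i j v) ∧
    z (.xi i j v) ≤ z (.delta i j v) ∧
    z (.xi i j v) ≤ B.deltaHi i j v * z (.x i (j - 1))
  mc_zeta : ∀ i, ∀ j ∈ Icc 2 (N + 1),
    B.rhoLo i * z (.x i (j - 1)) ≤ z (.zeta i j) ∧
    z (.rho i) + B.rhoHi i * (z (.x i (j - 1)) - 1) ≤ z (.zeta i j) ∧
    z (.zeta i j) ≤ B.rhoHi i * z (.x i (j - 1)) ∧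
    z (.zeta i j) ≤ z (.rho i) + B.rhoLo i * (z (.x i (j - 1)) - 1)

/-- The feasible set of the mixed-integer linear program. -/
def milpFeasibleSet (D : Data N) (B : Bounds N) : Set (Var N → ℝ) := {z | MILPFeasible D B z}

/-- `z` is an optimal solution of the mixed-integer linear program. -/
def IsOptimalMILP (D : Data N) (B : Bounds N) (z : Var N → ℝ) : Prop :=
  z ∈ milpFeasibleSet D B ∧ ∀ z' ∈ milpFeasibleSet D B, milpObj D z ≤ milpObj D z'

end DHRAS

end

/-! Fix `(x, a)`. Linear programming duality makes the second-stage cost a maximum of finitely many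
affine functions of the scenario. In the dual program each multiplier `y_j` is bounded below by
`-c^u_j` and satisfies `y_j - y_{j+1} ≤ c^w_j`, with `y_{N+2} = 0`. Making one of the two
constraints tight at every `j` amounts to cutting `{1, …, N + 2}` into intervals, with `y_j =
π_{j,v}` when the interval of `j` ends at `v`. The condition `c^u_{j+1} ≤ c^u_j + c^w_j` makes all
these points dual feasible, and complementary slackness with the greedy waiting times shows that one
of them is optimal (`exists_recourse_eq`).

The worst-case expectation is a moment problem on a box. Its dual chooses multipliers for the means
and pays the largest value, over all partitions and all scenarios of the box, of the affine function
minus the multipliers. The maximum over the box is explicit, coordinate by coordinate (`boxMax`).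
Since a route puts each customer at one position, this maximum is a sum over positions, each term
depending only on the position and the end of its interval (`partitionValue_stageValue`). Maximising
over partitions is therefore a longest path problem, whose dual potentials, taken as increments
`β_j`, give exactly the `β`-constraints.

Upper bound: the McCormick inequalities are exact for binary factors, so a feasible point of the
program yields an affine function above the second-stage cost on the support, and its integral is
the objective value (`integral_recourse_le`).

Lower bound: clamping confines the multipliers to a compact box, so the dual function has a
minimiser. Optimality there, by separation, produces weights on pairs (partition, vertex of the box)
under which the gradients cancel. Cancellation says that the weighted vertices have the prescribed
mean, so they form a distribution in the ambiguity set that attains the dual value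
(`exists_multiplier_and_distribution`). The clamping range also lies inside the McCormick bounds, so
the minimiser extends to a feasible point of the program (`solution_feasible`).

Attainment over `(x, a)` follows from continuity in the schedule, compactness, and the finiteness of
the set of routes up to irrelevant coordinates. -/

noncomputable section

namespace DHRAS

variable {N : ℕ}

/-! ### Partitions into intervals -/

/-- The end of the interval that contains `j` when `{1, …, m}` is cut after the elements of `B`. -/
def nextBreak (B : Finset ℕ) (m j : ℕ) : ℕ := sInf {b | j ≤ b ∧ b ∈ insert m B}

theorem nextBreak_mem (B : Finset ℕ) {m j : ℕ} (h : j ≤ m) :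
    j ≤ nextBreak B m j ∧ nextBreak B m j ∈ insert m B :=
  Nat.sInf_mem (s := {b | j ≤ b ∧ b ∈ insert m B}) ⟨m, h, by simp⟩

theorem nextBreak_le_of_mem {B : Finset ℕ} {m j b : ℕ} (hj : j ≤ b) (hb : b ∈ insert m B) :
    nextBreak B m j ≤ b := Nat.sInf_le ⟨hj, hb⟩

theorem nextBreak_le (B : Finset ℕ) {m j : ℕ} (h : j ≤ m) : nextBreak B m j ≤ m :=
  nextBreak_le_of_mem h (by simp)

theorem nextBreak_self {B : Finset ℕ} {m j : ℕ} (h : j ∈ B) : nextBreak B m j = j :=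
  le_antisymm (nextBreak_le_of_mem le_rfl (by simp [h]))
    (le_csInf ⟨j, le_rfl, by simp [h]⟩ fun _ hb => hb.1)

theorem nextBreak_last (B : Finset ℕ) (m : ℕ) : nextBreak B m m = m :=
  le_antisymm (nextBreak_le B le_rfl) (nextBreak_mem B le_rfl).1

theorem nextBreak_succ {B : Finset ℕ} {m j : ℕ} (h : j ∉ B) (hj : j ≠ m) :
    nextBreak B m j = nextBreak B m (j + 1) := by
  unfold nextBreak
  congr 1
  ext b
  simp only [Finset.mem_insert, Set.mem_ofPred_eq]
  constructor
  · rintro ⟨h1, h2⟩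
    refine ⟨?_, h2⟩
    rcases h1.lt_or_eq with h3 | rfl
    · exact h3
    · rcases h2 with h2 | h2
      · exact absurd h2 hj
      · exact absurd h2 h
  · rintro ⟨h1, h2⟩
    exact ⟨by omega, h2⟩

theorem nextBreak_insert_of_le {B : Finset ℕ} {b m j : ℕ} (hb : b < m)
    (hj : j ≤ b) : nextBreak (insert b B) m j = nextBreak B b j := by
  apply le_antisymm
  · obtain ⟨h1, h2⟩ := nextBreak_mem B hj
    exact nextBreak_le_of_mem h1 (Finset.mem_insert_of_mem h2)
  · obtain ⟨h1, h2⟩ := nextBreak_mem (insert b B) (hj.trans hb.le)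
    have h3 : nextBreak (insert b B) m j ≤ b := nextBreak_le_of_mem hj (by simp)
    refine nextBreak_le_of_mem h1 ?_
    rcases Finset.mem_insert.1 h2 with h4 | h4
    · omega
    · exact h4

theorem nextBreak_insert_of_lt {B : Finset ℕ} {b m j : ℕ} (hB : B ⊆ range b) (hbj : b < j)
    (hj : j ≤ m) : nextBreak (insert b B) m j = m := by
  obtain ⟨h1, h2⟩ := nextBreak_mem (insert b B) hj
  rcases Finset.mem_insert.1 h2 with h4 | h4
  · exact h4
  · rcases Finset.mem_insert.1 h4 with h5 | h5
    · omega
    · have := Finset.mem_range.1 (hB h5)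
      omega

theorem nextBreak_empty {m j : ℕ} (hj : j ≤ m) : nextBreak ∅ m j = m := by
  simpa using (nextBreak_mem ∅ hj).2

/-- The total value of a partition when the interval `[k, v]` has the value `∑ j ∈ [k, v], θ j v`. -/
def partitionValue (θ : ℕ → ℕ → ℝ) (B : Finset ℕ) (m : ℕ) : ℝ :=
  ∑ j ∈ Icc 1 m, θ j (nextBreak B m j)

theorem sum_Icc_one_split (f : ℕ → ℝ) {b m : ℕ} (h : b ≤ m) :
    ∑ j ∈ Icc 1 m, f j = ∑ j ∈ Icc 1 b, f j + ∑ j ∈ Icc (b + 1) m, f j := by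
  rw [← Finset.sum_union]
  · congr 1
    ext j
    simp only [Finset.mem_union, Finset.mem_Icc]
    omega
  · rw [Finset.disjoint_left]
    intro j
    simp only [Finset.mem_Icc]
    omega

/-- The recursion of the longest path problem: `b` is the last cut, so `[b + 1, m]` is the last
interval and the rest is a partition of `{1, …, b}`. -/
theorem partitionValue_insert (θ : ℕ → ℕ → ℝ) {B : Finset ℕ} {b m : ℕ} (hB : B ⊆ range b)
    (hb : b < m) :
    partitionValue θ (insert b B) m = partitionValue θ B b + ∑ j ∈ Icc (b + 1) m, θ j m := by
  unfold partitionValue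
  rw [sum_Icc_one_split _ hb.le]
  congr 1
  · refine Finset.sum_congr rfl fun j hj => ?_
    rw [nextBreak_insert_of_le hb (Finset.mem_Icc.1 hj).2]
  · refine Finset.sum_congr rfl fun j hj => ?_
    rw [nextBreak_insert_of_lt hB (Finset.mem_Icc.1 hj).1 (Finset.mem_Icc.1 hj).2]

/-- Weak duality for the longest path problem: sum the interval inequalities along the partition,
removing the last interval at each step of the induction. -/
theorem partitionValue_le_sum {θ : ℕ → ℕ → ℝ} {β : ℕ → ℝ} {n : ℕ}
    (h : ∀ k v, 1 ≤ k → k ≤ v → v ≤ n → ∑ j ∈ Icc k v, θ j v ≤ ∑ j ∈ Icc k v, β j)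
    (m : ℕ) (hm : m ≤ n) {B : Finset ℕ} (hB : B ⊆ range m) :
    partitionValue θ B m ≤ ∑ j ∈ Icc 1 m, β j := by
  induction m using Nat.strong_induction_on generalizing B with
  | _ m ih =>
    rcases Nat.eq_zero_or_pos m with rfl | hm0
    · simp [partitionValue]
    rcases B.eq_empty_or_nonempty with rfl | hne
    · refine le_trans (le_of_eq ?_) (h 1 m le_rfl hm0 hm)
      refine Finset.sum_congr rfl fun j hj => ?_
      rw [nextBreak_empty (Finset.mem_Icc.1 hj).2]
    · set b := B.max' hne with hb
      have hbB : b ∈ B := B.max'_mem hne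
      have hbm : b < m := Finset.mem_range.1 (hB hbB)
      have hsub : B.erase b ⊆ range b := by
        intro c hc
        have h1 := B.le_max' c (Finset.mem_of_mem_erase hc)
        have h2 := Finset.ne_of_mem_erase hc
        rw [Finset.mem_range]
        omega
      rw [← Finset.insert_erase hbB, partitionValue_insert θ hsub hbm, sum_Icc_one_split _ hbm.le]
      exact add_le_add (ih b hbm (by omega) hsub) (h (b + 1) m (by omega) hbm hm)

/-- The largest value of a partition of `{1, …, m}`. -/
def bestPartition (θ : ℕ → ℕ → ℝ) (m : ℕ) : ℝ :=
  ((range m).powerset).sup' (Finset.powerset_nonempty _) fun B => partitionValue θ B m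

theorem bestPartition_zero (θ : ℕ → ℕ → ℝ) : bestPartition θ 0 = 0 := by
  simp [bestPartition, partitionValue]

theorem partitionValue_le_best (θ : ℕ → ℕ → ℝ) {B : Finset ℕ} {m : ℕ} (hB : B ⊆ range m) :
    partitionValue θ B m ≤ bestPartition θ m :=
  Finset.le_sup' (fun B => partitionValue θ B m) (Finset.mem_powerset.2 hB)

theorem exists_partitionValue_eq_best (θ : ℕ → ℕ → ℝ) (m : ℕ) :
    ∃ B ⊆ range m, bestPartition θ m = partitionValue θ B m := by
  obtain ⟨B, hB, h⟩ := Finset.exists_mem_eq_sup' (s := (range m).powerset) (Finset.powerset_nonempty _)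
    fun B => partitionValue θ B m
  exact ⟨B, Finset.mem_powerset.1 hB, h⟩

theorem sum_bestPartition_increments (θ : ℕ → ℕ → ℝ) {k v : ℕ} (h1 : 1 ≤ k) (h : k ≤ v + 1) :
    ∑ j ∈ Icc k v, (bestPartition θ j - bestPartition θ (j - 1))
      = bestPartition θ v - bestPartition θ (k - 1) := by
  induction v with
  | zero =>
    obtain rfl : k = 1 := by omega
    simp
  | succ v ih =>
    rcases h.lt_or_eq with h2 | rfl
    · rw [Finset.sum_Icc_succ_top (by omega), ih (by omega)]
      simp
    · simp

/-- Bellman's inequality: an optimal partition of `{1, …, k - 1}` followed by `[k, v]` is a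
competitor for `{1, …, v}`. Hence the increments of the best value satisfy every interval
constraint. For `k = 1` the added cut is `0`, which separates nothing. -/
theorem sum_le_bestPartition_sub (θ : ℕ → ℕ → ℝ) {k v : ℕ} (h1 : 1 ≤ k) (h : k ≤ v) :
    ∑ j ∈ Icc k v, θ j v ≤ ∑ j ∈ Icc k v, (bestPartition θ j - bestPartition θ (j - 1)) := by
  rw [sum_bestPartition_increments θ h1 (by omega)]
  obtain ⟨B, hB, hV⟩ := exists_partitionValue_eq_best θ (k - 1)
  have h2 := partitionValue_insert θ hB (show k - 1 < v by omega)
  have h3 : partitionValue θ (insert (k - 1) B) v ≤ bestPartition θ v := by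
    apply partitionValue_le_best
    intro c hc
    rcases Finset.mem_insert.1 hc with rfl | hc
    · rw [Finset.mem_range]; omega
    · have := Finset.mem_range.1 (hB hc)
      rw [Finset.mem_range]; omega
  rw [Nat.sub_add_cancel h1] at h2
  linarith

/-! ### Dual solutions of the second-stage program -/

/-- The hypotheses on the cost coefficients. -/
structure CostConditions (D : Data N) : Prop where
  pos : 1 ≤ N
  cw_nonneg : ∀ j ∈ Icc 1 N, 0 ≤ D.cw j
  cu_nonneg : ∀ j ∈ Icc 1 N, 0 ≤ D.cu j
  co_nonneg : 0 ≤ D.co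
  step : ∀ j, 1 ≤ j → j + 1 ≤ N → D.cu (j + 1) ≤ D.cu j + D.cw j

theorem CostConditions.cwExt_nonneg {D : Data N} (h : CostConditions D) {j : ℕ} (hj : 1 ≤ j) :
    0 ≤ D.cwExt j := by
  unfold Data.cwExt
  split_ifs with h1 h2
  · exact h.cw_nonneg j (Finset.mem_Icc.2 ⟨hj, h1⟩)
  · exact h.co_nonneg
  · exact le_rfl

/-- Beyond position `N` the left side is zero, so nonnegativity of the costs replaces the
hypothesis. -/
theorem CostConditions.cuExt_succ_le {D : Data N} (h : CostConditions D) {j : ℕ} (hj : 1 ≤ j) :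
    D.cuExt (j + 1) ≤ D.cuExt j + D.cwExt j := by
  by_cases h1 : j + 1 ≤ N
  · have := h.step j hj h1
    simpa [Data.cuExt, Data.cwExt, h1, show j ≤ N by omega] using this
  · have h2 : D.cuExt (j + 1) = 0 := by simp [Data.cuExt, h1]
    have h3 : 0 ≤ D.cuExt j := by
      unfold Data.cuExt
      split_ifs with h4
      · exact h.cu_nonneg j (Finset.mem_Icc.2 ⟨hj, h4⟩)
      · exact le_rfl
    have := h.cwExt_nonneg hj
    linarith

theorem pi_self (D : Data N) (j : ℕ) : D.pi j j = -D.cuExt j := by simp [Data.pi]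

theorem pi_eq_add (D : Data N) {j v : ℕ} (h : j < v) : D.pi j v = D.cwExt j + D.pi (j + 1) v := by
  unfold Data.pi
  rw [Finset.sum_eq_sum_Ico_succ_bot h]
  ring

theorem pi_last (D : Data N) : D.pi (N + 2) (N + 2) = 0 := by simp [pi_self, Data.cuExt]

/-- Iterating the cost condition from `j` to `v` gives `c^u_v ≤ c^u_j + ∑_{l=j}^{v-1} c^w_l`. This
is the dual constraint of the idling variable `u_j`. -/
theorem CostConditions.neg_cuExt_le_pi {D : Data N} (h : CostConditions D) {j v : ℕ} (hj : 1 ≤ j)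
    (hv : j ≤ v) : -D.cuExt j ≤ D.pi j v := by
  induction v, hv using Nat.le_induction with
  | base => rw [pi_self]
  | succ v hv ih =>
    refine ih.trans ?_
    have := h.cuExt_succ_le (hj.trans hv)
    unfold Data.pi
    rw [Finset.sum_Ico_succ_top hv]
    linarith

/-- The dual solution that belongs to a partition of the positions `1, …, N + 2`. -/
def dualSol (D : Data N) (B : Finset ℕ) (j : ℕ) : ℝ := D.pi j (nextBreak B (N + 2) j)

theorem dualSol_last (D : Data N) (B : Finset ℕ) : dualSol D B (N + 2) = 0 := by
  rw [dualSol, nextBreak_last, pi_last]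

theorem CostConditions.neg_cuExt_le_dualSol {D : Data N} (h : CostConditions D) (B : Finset ℕ)
    {j : ℕ} (hj : j ∈ Icc 1 (N + 2)) : -D.cuExt j ≤ dualSol D B j :=
  h.neg_cuExt_le_pi (Finset.mem_Icc.1 hj).1 (nextBreak_mem B (Finset.mem_Icc.1 hj).2).1

theorem dualSol_of_mem (D : Data N) {B : Finset ℕ} {j : ℕ} (hj : j ∈ B) :
    dualSol D B j = -D.cuExt j := by rw [dualSol, nextBreak_self hj, pi_self]

theorem dualSol_of_notMem (D : Data N) {B : Finset ℕ} {j : ℕ} (hj : j ∉ B) (hj' : j ≤ N + 1) :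
    dualSol D B j = D.cwExt j + dualSol D B (j + 1) := by
  have h1 := (nextBreak_mem B (show j + 1 ≤ N + 2 by omega)).1
  rw [dualSol, dualSol, nextBreak_succ hj (by omega), pi_eq_add D (by omega)]

/-- The dual constraint of the waiting variable `w_j`: tight inside an interval, and at a cut a
consequence of `y_{j+1} ≥ -c^u_{j+1}` and the cost condition. -/
theorem CostConditions.dualSol_sub_le {D : Data N} (h : CostConditions D) (B : Finset ℕ)
    {j : ℕ} (hj : j ∈ Icc 1 (N + 1)) : dualSol D B j - dualSol D B (j + 1) ≤ D.cwExt j := by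
  obtain ⟨h1, h2⟩ := Finset.mem_Icc.1 hj
  by_cases hB : j ∈ B
  · rw [dualSol_of_mem D hB]
    have h3 := h.neg_cuExt_le_dualSol B (j := j + 1) (Finset.mem_Icc.2 ⟨by omega, by omega⟩)
    have h4 := h.cuExt_succ_le h1
    linarith
  · rw [dualSol_of_notMem D hB h2]
    linarith

/-! ### The second-stage program -/

/-- The right-hand sides of the second-stage program. -/
def load (x : Fin N → ℕ → ℝ) (a : ℕ → ℝ) (s : Scenario N) (j : ℕ) : ℝ :=
  if j = 1 then (∑ i, s.travel 0 i.succ * x i 1) - a 1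
  else a (j - 1) - a j + (∑ i, s.1 i * x i (j - 1))
    + ∑ i, ∑ i' ∈ univ.erase i, s.travel i.succ i'.succ * x i (j - 1) * x i' j

/-- The value of the dual solution of a partition. -/
def cutValue (D : Data N) (x : Fin N → ℕ → ℝ) (a : ℕ → ℝ) (s : Scenario N) (B : Finset ℕ) : ℝ :=
  ∑ j ∈ Icc 1 (N + 1), load x a s j * dualSol D B j + D.lam * travelTime x s

theorem recourse_cost_eq (D : Data N) (u w : ℕ → ℝ) :
    (∑ j ∈ Icc 1 N, (D.cw j * w j + D.cu j * u j)) + D.co * w (N + 1)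
      = ∑ j ∈ Icc 1 (N + 1), (D.cwExt j * w j + D.cuExt j * u j) := by
  rw [Finset.sum_Icc_succ_top (by omega)]
  congr 1
  · refine Finset.sum_congr rfl fun j hj => ?_
    simp [Data.cwExt, Data.cuExt, (Finset.mem_Icc.1 hj).2]
  · simp [Data.cwExt, Data.cuExt]

/-- The conventions `w_0 = 0` and `x_{i,N+1} = 0` bring the first and last equations into the form
of the middle ones. -/
theorem recourseFeasible_iff (hN : 1 ≤ N) {x : Fin N → ℕ → ℝ} (hx : x ∈ routes N) (a : ℕ → ℝ)
    (s : Scenario N) (u w : ℕ → ℝ) (hw : w 0 = 0) :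
    RecourseFeasible x a s u w ↔
      ∀ j ∈ Icc 1 (N + 1), w j - w (j - 1) - u j = load x a s j ∧ 0 ≤ w j ∧ 0 ≤ u j := by
  have hlast : load x a s (N + 1) = a N - a (N + 1) + ∑ i, s.1 i * x i N := by
    simp [load, hx.2.2.2, show N ≠ 0 by omega]
  constructor
  · intro h j hj
    refine ⟨?_, h.nonneg j hj⟩
    obtain ⟨h1, h2⟩ := Finset.mem_Icc.1 hj
    rcases h1.lt_or_eq with h3 | rfl
    · rcases h2.lt_or_eq with h4 | rfl
      · rw [h.middle j (Finset.mem_Icc.2 ⟨h3, by omega⟩), load, if_neg (by omega)]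
      · rw [hlast, ← h.last]; simp
    · have := h.first
      simp only [load, if_true]
      rw [← this]
      simp [hw]
  · intro h
    refine ⟨?_, ?_, ?_, fun j hj => (h j hj).2⟩
    · have := (h 1 (by simp)).1
      simpa [load, hw] using this
    · intro j hj
      obtain ⟨h1, h2⟩ := Finset.mem_Icc.1 hj
      rw [(h j (Finset.mem_Icc.2 ⟨by omega, by omega⟩)).1, load, if_neg (by omega)]
    · have := (h (N + 1) (by simp)).1
      rw [hlast] at this
      simpa using this

/-- Summation by parts writes the duality gap as primal variables times dual slacks. Weak duality
and complementary slackness are both read off from it. -/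
theorem lagrangian_identity (c e y u w r : ℕ → ℝ) (hw : w 0 = 0) (m : ℕ)
    (h : ∀ j ∈ Icc 1 m, w j - w (j - 1) - u j = r j) :
    ∑ j ∈ Icc 1 m, (c j * w j + e j * u j) - ∑ j ∈ Icc 1 m, r j * y j
      = ∑ j ∈ Icc 1 m, (w j * (c j - (y j - y (j + 1))) + u j * (e j + y j))
        - w m * y (m + 1) := by
  induction m with
  | zero => simp [hw]
  | succ m ih =>
    have h1 := ih fun j hj => h j (Finset.mem_Icc.2
      ⟨(Finset.mem_Icc.1 hj).1, (Finset.mem_Icc.1 hj).2.trans (by omega)⟩)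
    have h2 := h (m + 1) (by simp)
    simp only [Nat.add_sub_cancel] at h2
    rw [Finset.sum_Icc_succ_top (by omega), Finset.sum_Icc_succ_top (by omega),
      Finset.sum_Icc_succ_top (by omega), ← h2]
    linear_combination h1

theorem cost_sub_cutValue (D : Data N) (B : Finset ℕ) (u w r : ℕ → ℝ) (hw : w 0 = 0)
    (h : ∀ j ∈ Icc 1 (N + 1), w j - w (j - 1) - u j = r j) :
    ∑ j ∈ Icc 1 (N + 1), (D.cwExt j * w j + D.cuExt j * u j)
        - ∑ j ∈ Icc 1 (N + 1), r j * dualSol D B j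
      = ∑ j ∈ Icc 1 (N + 1), (w j * (D.cwExt j - (dualSol D B j - dualSol D B (j + 1)))
          + u j * (D.cuExt j + dualSol D B j)) := by
  rw [lagrangian_identity _ _ (dualSol D B) u w r hw (N + 1) h, dualSol_last]
  ring

theorem CostConditions.cutValue_le {D : Data N} (h : CostConditions D) {x : Fin N → ℕ → ℝ}
    (hx : x ∈ routes N) {a : ℕ → ℝ} {s : Scenario N} (B : Finset ℕ) {r : ℝ}
    (hr : r ∈ recourseValues D x a s) : cutValue D x a s B ≤ r := by
  obtain ⟨u, w, hf, rfl⟩ := hr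
  -- The second-stage constraints leave `w 0` free; it is reset to the value that the uniform
  -- equations need.
  set w' : ℕ → ℝ := Function.update w 0 0 with hw'
  have hww : ∀ j, 1 ≤ j → w' j = w j := fun j hj => by
    rw [hw', Function.update_of_ne (by omega)]
  have hf' : RecourseFeasible x a s u w' := by
    refine ⟨?_, ?_, ?_, ?_⟩
    · rw [hww 1 le_rfl]; exact hf.first
    · intro j hj
      have := (Finset.mem_Icc.1 hj).1
      rw [hww j (by omega), hww (j - 1) (by omega)]; exact hf.middle j hj
    · rw [hww _ (by omega), hww N h.pos]; exact hf.last
    · intro j hj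
      rw [hww j (Finset.mem_Icc.1 hj).1]; exact hf.nonneg j hj
  rw [recourseFeasible_iff h.pos hx a s u w' (by simp [hw'])] at hf'
  have key := cost_sub_cutValue D B u w' _ (by simp [hw']) fun j hj => (hf' j hj).1
  have hnn : 0 ≤ ∑ j ∈ Icc 1 (N + 1),
      (w' j * (D.cwExt j - (dualSol D B j - dualSol D B (j + 1)))
          + u j * (D.cuExt j + dualSol D B j)) := by
    refine Finset.sum_nonneg fun j hj => ?_
    have h1 := h.dualSol_sub_le B hj
    have h2 := h.neg_cuExt_le_dualSol B (j := j)
      (Finset.mem_Icc.2 ⟨(Finset.mem_Icc.1 hj).1, (Finset.mem_Icc.1 hj).2.trans (by omega)⟩)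
    exact add_nonneg (mul_nonneg (hf' j hj).2.1 (by linarith))
      (mul_nonneg (hf' j hj).2.2 (by linarith))
  rw [recourse_cost_eq, cutValue]
  have : ∑ j ∈ Icc 1 (N + 1), (D.cwExt j * w' j + D.cuExt j * u j)
      = ∑ j ∈ Icc 1 (N + 1), (D.cwExt j * w j + D.cuExt j * u j) :=
    Finset.sum_congr rfl fun j hj => by rw [hww j (Finset.mem_Icc.1 hj).1]
  linarith

/-- The waiting times when nobody idles before the appointed time more than necessary. -/
def greedyWait (r : ℕ → ℝ) : ℕ → ℝ
  | 0 => 0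
  | j + 1 => max 0 (greedyWait r j + r (j + 1))

theorem greedyWait_nonneg (r : ℕ → ℝ) (j : ℕ) : 0 ≤ greedyWait r j := by
  cases j with
  | zero => exact le_rfl
  | succ j => exact le_max_left _ _

theorem CostConditions.exists_cutValue_mem {D : Data N} (h : CostConditions D)
    {x : Fin N → ℕ → ℝ} (hx : x ∈ routes N) (a : ℕ → ℝ) (s : Scenario N) :
    ∃ B ⊆ range (N + 2), cutValue D x a s B ∈ recourseValues D x a s := by
  set w := greedyWait (load x a s) with hw
  set u : ℕ → ℝ := fun j => w j - w (j - 1) - load x a s j with hu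
  have hstep : ∀ j, 1 ≤ j → w j = max 0 (w (j - 1) + load x a s j) := by
    intro j hj
    obtain ⟨k, rfl⟩ := Nat.exists_eq_add_of_le' hj
    simp [hw, greedyWait]
  have hu0 : ∀ j, 1 ≤ j → 0 ≤ u j := by
    intro j hj
    have := le_max_right 0 (w (j - 1) + load x a s j)
    rw [← hstep j hj] at this
    simp only [hu]
    linarith
  -- Cuts are placed where the greedy waiting time vanishes. At a cut the idling constraint of the
  -- dual is tight; elsewhere `w_j > 0` forces `u_j = 0` and the waiting constraint is tight, so the
  -- duality gap is zero.
  refine ⟨(range (N + 2)).filter fun j => w j = 0, Finset.filter_subset _ _, u, w, ?_, ?_⟩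
  · rw [recourseFeasible_iff h.pos hx a s u w rfl]
    intro j hj
    exact ⟨by simp only [hu]; ring, greedyWait_nonneg _ j, hu0 j (Finset.mem_Icc.1 hj).1⟩
  · rw [recourse_cost_eq, cutValue]
    congr 1
    rw [eq_comm, ← sub_eq_zero, cost_sub_cutValue D _ u w (load x a s) rfl
      fun j _ => by simp only [hu]; ring]
    refine Finset.sum_eq_zero fun j hj => ?_
    obtain ⟨h1, h2⟩ := Finset.mem_Icc.1 hj
    by_cases hwj : w j = 0
    · rw [dualSol_of_mem D (by simp [hwj]; omega), hwj]
      ring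
    · have h3 : u j = 0 := by
        have := hstep j h1
        rcases le_total (w (j - 1) + load x a s j) 0 with h4 | h4
        · rw [max_eq_left h4] at this
          exact absurd this hwj
        · rw [max_eq_right h4] at this
          simp only [hu]
          linarith
      rw [h3, dualSol_of_notMem D (by simp [hwj]) h2]
      ring

theorem CostConditions.exists_recourse_eq {D : Data N} (h : CostConditions D)
    {x : Fin N → ℕ → ℝ} (hx : x ∈ routes N) (a : ℕ → ℝ) (s : Scenario N) :
    ∃ B ⊆ range (N + 2), recourse D x a s = cutValue D x a s B ∧
      IsLeast (recourseValues D x a s) (recourse D x a s) := by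
  obtain ⟨B, hB, hmem⟩ := h.exists_cutValue_mem hx a s
  have hl : IsLeast (recourseValues D x a s) (cutValue D x a s B) :=
    ⟨hmem, fun r hr => h.cutValue_le hx B hr⟩
  have he : recourse D x a s = cutValue D x a s B := hl.csInf_eq
  exact ⟨B, hB, he, he ▸ hl⟩

theorem CostConditions.cutValue_le_recourse {D : Data N} (h : CostConditions D)
    {x : Fin N → ℕ → ℝ} (hx : x ∈ routes N) (a : ℕ → ℝ) (s : Scenario N) (B : Finset ℕ) :
    cutValue D x a s B ≤ recourse D x a s := by
  obtain ⟨_, _, _, hl⟩ := h.exists_recourse_eq hx a s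
  exact h.cutValue_le hx B hl.1

/-! ### Strong duality for moment problems on a box -/

/-- First-order optimality for a minimum of a maximum of finitely many affine functions. -/
theorem exists_stdSimplex_of_minimax {ι E : Type*} [Fintype ι] [Fintype E]
    (A : ι → ℝ) (G : ι → E → ℝ) (θ₀ : E → ℝ) (m : ℝ)
    (hmax : ∀ i, A i + ∑ e, G i e * θ₀ e ≤ m)
    (hmin : ∀ θ : E → ℝ, ∃ i, m ≤ A i + ∑ e, G i e * θ e) :
    ∃ p ∈ stdSimplex ℝ ι, (∀ e, ∑ i, p i * G i e = 0) ∧ ∑ i, p i * A i = m := by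
  classical
  set gap : ι → ℝ := fun i => m - (A i + ∑ e, G i e * θ₀ e) with hgap
  have hgap0 : ∀ i, 0 ≤ gap i := fun i => sub_nonneg.2 (hmax i)
  let T : (ι → ℝ) →ₗ[ℝ] ((E → ℝ) × ℝ) :=
    { toFun := fun p => (fun e => ∑ i, p i * G i e, ∑ i, p i * gap i)
      map_add' := fun p q => by
        ext <;> simp [add_mul, Finset.sum_add_distrib]
      map_smul' := fun r p => by
        ext <;> simp [Finset.mul_sum, mul_assoc] }
  have hTc : Continuous T := T.continuous_of_finiteDimensional
  by_cases h0 : (0 : (E → ℝ) × ℝ) ∈ T '' stdSimplex ℝ ι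
  · obtain ⟨p, hp, hTp⟩ := h0
    have h1 : ∀ e, ∑ i, p i * G i e = 0 := fun e => congrFun (congrArg Prod.fst hTp) e
    have h2 : ∑ i, p i * gap i = 0 := congrArg Prod.snd hTp
    refine ⟨p, hp, h1, ?_⟩
    have h3 : ∑ i, p i * (∑ e, G i e * θ₀ e) = 0 := by
      simp_rw [Finset.mul_sum, ← mul_assoc]
      rw [Finset.sum_comm]
      simp_rw [← Finset.sum_mul, h1]
      simp
    simp only [hgap, mul_sub, mul_add, Finset.sum_sub_distrib, Finset.sum_add_distrib, h3,
      ← Finset.sum_mul, hp.2] at h2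
    linarith
  · exfalso
    obtain ⟨f, u, hf, hu⟩ := geometric_hahn_banach_closed_point
      ((convex_stdSimplex ℝ ι).linear_image T)
      ((isCompact_stdSimplex ℝ ι).image hTc).isClosed h0
    rw [map_zero] at hu
    set d : E → ℝ := fun e => f (Pi.single e 1, 0) with hd
    set τ : ℝ := f (0, 1) with hτ
    have hfi : ∀ i, f (G i, gap i) < u := by
      intro i
      have := hf (T (Pi.single i 1)) ⟨_, single_mem_stdSimplex ℝ i, rfl⟩
      have hT : T (Pi.single i 1) = (G i, gap i) := by
        ext <;> simp [T, Pi.single_apply]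
      rwa [hT] at this
    have hfe : ∀ i, f (G i, gap i) = ∑ e, G i e * d e + gap i * τ := by
      intro i
      have h1 : ((G i, gap i) : (E → ℝ) × ℝ)
          = ∑ e, G i e • ((Pi.single e 1, 0) : (E → ℝ) × ℝ) + gap i • ((0, 1) : (E → ℝ) × ℝ) := by
        ext e
        · simp [Prod.fst_sum, Finset.sum_apply, Pi.single_apply]
        · simp [Prod.snd_sum]
      rw [h1, map_add, map_sum]
      simp_rw [map_smul]
      rfl
    -- A step of length `t` in the separating direction `d` lowers every function below `m`: active
    -- ones by strict separation, inactive ones because `t * |τ| ≤ 1` keeps the possible increase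
    -- below the gap. This contradicts `hmin`.
    set t : ℝ := 1 / (1 + |τ|) with ht
    have hpos : 0 < 1 + |τ| := by positivity
    have ht0 : 0 < t := by positivity
    have ht1 : t * |τ| ≤ 1 := by
      rw [ht, one_div_mul_eq_div, div_le_one hpos]
      linarith
    obtain ⟨i, hi⟩ := hmin fun e => θ₀ e + t * d e
    have h1 : A i + ∑ e, G i e * (θ₀ e + t * d e) = m - gap i + t * ∑ e, G i e * d e := by
      simp only [hgap, mul_add, Finset.sum_add_distrib, Finset.mul_sum]
      have : ∑ e, G i e * (t * d e) = ∑ e, t * (G i e * d e) :=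
        Finset.sum_congr rfl fun e _ => by ring
      rw [this]
      ring
    have h2 := hfi i
    rw [hfe] at h2
    rw [h1] at hi
    have h3 : t * ∑ e, G i e * d e < t * (u - gap i * τ) :=
      mul_lt_mul_of_pos_left (by linarith) ht0
    have h4 : -(gap i * τ) ≤ gap i * |τ| := by
      rw [← mul_neg]
      exact mul_le_mul_of_nonneg_left (neg_le_abs τ) (hgap0 i)
    have h5 : t * (-(gap i * τ)) ≤ gap i := by
      calc t * (-(gap i * τ)) ≤ t * (gap i * |τ|) := mul_le_mul_of_nonneg_left h4 ht0.le
        _ = gap i * (t * |τ|) := by ring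
        _ ≤ gap i * 1 := mul_le_mul_of_nonneg_left ht1 (hgap0 i)
        _ = gap i := mul_one _
    have h6 : t * u < 0 := mul_neg_of_pos_of_neg ht0 hu
    linarith

/-- The vertices of a box. -/
def vertex {E : Type*} (lo hi : E → ℝ) (V : E → Bool) (e : E) : ℝ := if V e then hi e else lo e

/-- The largest value of `y * c` for `y` between `lo` and `hi`. -/
def boxMax (lo hi c : ℝ) : ℝ := lo * c + (hi - lo) * max 0 c

theorem mul_le_boxMax {lo hi y c : ℝ} (h1 : lo ≤ y) (h2 : y ≤ hi) : y * c ≤ boxMax lo hi c := by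
  have h3 : (y - lo) * c ≤ (hi - lo) * max 0 c :=
    (mul_le_mul_of_nonneg_left (le_max_right 0 c) (by linarith)).trans
      (mul_le_mul_of_nonneg_right (by linarith) (le_max_left 0 c))
  unfold boxMax
  linarith

theorem boxMax_of_nonneg (lo hi : ℝ) {c : ℝ} (h : 0 ≤ c) : boxMax lo hi c = hi * c := by
  rw [boxMax, max_eq_right h]; ring

theorem boxMax_of_nonpos (lo hi : ℝ) {c : ℝ} (h : c ≤ 0) : boxMax lo hi c = lo * c := by
  rw [boxMax, max_eq_left h]; ring

/-- Moving a multiplier into the range of the coefficients does not increase the dual function. -/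
theorem clamp_le {lo hi mean c cl ch : ℝ} (h1 : lo ≤ mean) (h2 : mean ≤ hi) (hl : cl ≤ c)
    (hh : c ≤ ch) (θ : ℝ) :
    mean * max cl (min ch θ) + boxMax lo hi (c - max cl (min ch θ))
      ≤ mean * θ + boxMax lo hi (c - θ) := by
  -- Below `c`, hence below `cl`, the function of `θ` has slope `mean - hi ≤ 0`; above `c`, hence
  -- above `ch`, it has slope `mean - lo ≥ 0`.
  rcases le_total θ ch with h3 | h3
  · rw [min_eq_right h3]
    rcases le_total cl θ with h4 | h4
    · rw [max_eq_right h4]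
    · rw [max_eq_left h4, boxMax_of_nonneg _ _ (by linarith), boxMax_of_nonneg _ _ (by linarith)]
      nlinarith
  · rw [min_eq_left h3, max_eq_right (hl.trans hh), boxMax_of_nonpos _ _ (by linarith),
      boxMax_of_nonpos _ _ (by linarith)]
    nlinarith

/-- Strong duality with both optima exhibited: `θ` minimises the dual function, and the weights `p`
come from optimality at `θ`. The dual function is a maximum of affine functions of `θ`, one for each
`k` and each vertex, with gradient `mean - vertex`; vanishing of the averaged gradient is the mean
condition. -/
theorem exists_multiplier_and_distribution {K E : Type*} [Fintype K] [Nonempty K] [Fintype E]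
    [DecidableEq E] (c : K → E → ℝ) (b : K → ℝ) {lo hi mean cl ch : E → ℝ}
    (hlo : ∀ e, lo e ≤ mean e) (hhi : ∀ e, mean e ≤ hi e)
    (hc : ∀ k e, cl e ≤ c k e ∧ c k e ≤ ch e) :
    ∃ θ : E → ℝ, (∀ e, cl e ≤ θ e ∧ θ e ≤ ch e) ∧
      ∃ p ∈ stdSimplex ℝ (K × (E → Bool)),
        (∀ e, ∑ i, p i * vertex lo hi i.2 e = mean e) ∧
        ∀ k, b k + ∑ e, (mean e * θ e + boxMax (lo e) (hi e) (c k e - θ e))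
          ≤ ∑ i, p i * (b i.1 + ∑ e, vertex lo hi i.2 e * c i.1 e) := by
  classical
  set Ψ : K → (E → ℝ) → ℝ := fun k θ =>
    b k + ∑ e, (mean e * θ e + boxMax (lo e) (hi e) (c k e - θ e)) with hΨ
  set Φ : (E → ℝ) → ℝ := fun θ => univ.sup' univ_nonempty fun k => Ψ k θ with hΦ
  have hcont : Continuous Φ := by
    refine Continuous.finset_sup'_apply _ fun k _ => ?_
    simp only [hΨ, boxMax]
    fun_prop
  have hclch : cl ≤ ch := fun e => (hc (Classical.arbitrary K) e).1.trans (hc _ e).2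
  obtain ⟨θ₀, hθ₀, hmin⟩ := (isCompact_Icc (a := cl) (b := ch)).exists_isMinOn
    (Set.nonempty_Icc.2 hclch) hcont.continuousOn
  -- The minimum over the compact box is global, since clamping into the box does not increase any
  -- `Ψ k`.
  have hglob : ∀ θ, Φ θ₀ ≤ Φ θ := by
    intro θ
    have hmem : (fun e => max (cl e) (min (ch e) (θ e))) ∈ Set.Icc cl ch :=
      ⟨fun e => le_max_left _ _, fun e => max_le (hclch e) (min_le_left _ _)⟩
    refine (hmin hmem).trans (Finset.sup'_mono_fun fun k _ => ?_)
    exact add_le_add le_rfl (Finset.sum_le_sum fun e _ =>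
      clamp_le (hlo e) (hhi e) (hc k e).1 (hc k e).2 (θ e))
  set A : K × (E → Bool) → ℝ := fun i => b i.1 + ∑ e, vertex lo hi i.2 e * c i.1 e with hA
  set G : K × (E → Bool) → E → ℝ := fun i e => mean e - vertex lo hi i.2 e with hG
  have hAG : ∀ i (θ : E → ℝ), A i + ∑ e, G i e * θ e
      = b i.1 + ∑ e, (mean e * θ e + vertex lo hi i.2 e * (c i.1 e - θ e)) := by
    intro i θ
    simp only [hA, hG, add_assoc, ← Finset.sum_add_distrib]
    congr 1
    exact Finset.sum_congr rfl fun e _ => by ring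
  obtain ⟨p, hp, hp1, hp2⟩ := exists_stdSimplex_of_minimax A G θ₀ (Φ θ₀)
    (by
      intro i
      rw [hAG]
      refine le_trans ?_ (Finset.le_sup' (fun k => Ψ k θ₀) (mem_univ i.1))
      refine add_le_add le_rfl (Finset.sum_le_sum fun e _ => add_le_add le_rfl ?_)
      refine mul_le_boxMax ?_ ?_ <;> unfold vertex <;> split_ifs <;>
        first | exact le_rfl | exact (hlo e).trans (hhi e))
    (by
      intro θ
      obtain ⟨k, -, hk⟩ := Finset.exists_mem_eq_sup' (univ_nonempty (α := K)) fun k => Ψ k θ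
      -- The vertex attaining `boxMax`: the upper end exactly where the coefficient is nonnegative.
      refine ⟨(k, fun e => decide (0 ≤ c k e - θ e)), ?_⟩
      rw [hAG]
      refine (hglob θ).trans (le_of_eq (hk.trans ?_))
      simp only [hΨ]
      congr 1
      refine Finset.sum_congr rfl fun e _ => ?_
      by_cases h : 0 ≤ c k e - θ e
      · rw [boxMax_of_nonneg _ _ h]
        simp [vertex, h]
      · rw [boxMax_of_nonpos _ _ (not_le.1 h).le]
        simp only [vertex, h]
        simp)
  refine ⟨θ₀, fun e => ⟨hθ₀.1 e, hθ₀.2 e⟩, p, hp, ?_, ?_⟩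
  · intro e
    have := hp1 e
    simp only [hG, mul_sub, Finset.sum_sub_distrib, ← Finset.sum_mul, hp.2] at this
    linarith
  · intro k
    rw [hp2]
    exact Finset.le_sup' (fun k => Ψ k θ₀) (mem_univ k)

/-! ### The second-stage cost as a maximum of affine functions of the scenario -/

/-- Separates the arcs at the depot from those between customers, as the route costs treat them
differently. -/
theorem sum_arc (F : Fin (N + 1) → Fin (N + 1) → ℝ) :
    ∑ e : Arc N, F e.1.1 e.1.2 = (∑ i : Fin N, (F 0 i.succ + F i.succ 0))
      + ∑ i : Fin N, ∑ i' ∈ univ.erase i, F i.succ i'.succ := by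
  have h1 : ∑ e : Arc N, F e.1.1 e.1.2 = ∑ p : Fin (N + 1), ∑ q, if p ≠ q then F p q else 0 := by
    rw [← Fintype.sum_prod_type' (f := fun p q => if p ≠ q then F p q else 0),
      ← Finset.sum_filter]
    exact (Finset.sum_subtype (univ.filter fun e : Fin (N + 1) × Fin (N + 1) => e.1 ≠ e.2)
      (by simp) fun e => F e.1 e.2).symm
  have h2 : ∀ i : Fin N, ∑ i' ∈ univ.erase i, F i.succ i'.succ
      = ∑ i' : Fin N, if i ≠ i' then F i.succ i'.succ else 0 := by
    intro i
    rw [← Finset.sum_filter]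
    refine Finset.sum_congr ?_ fun _ _ => rfl
    ext i'
    simp [eq_comm]
  rw [h1, Fin.sum_univ_succ]
  simp only [h2, Fin.sum_univ_succ, ne_eq, not_true_eq_false, if_false, Fin.succ_ne_zero,
    (Fin.succ_ne_zero _).symm, not_false_eq_true, if_true, Fin.succ_inj,
    Finset.sum_add_distrib]
  ring

theorem travel_of_ne (s : Scenario N) {p q : Fin (N + 1)} (h : p ≠ q) :
    s.travel p q = s.2 ⟨(p, q), h⟩ := dif_pos h

theorem travel_arc (s : Scenario N) (e : Arc N) : s.travel e.1.1 e.1.2 = s.2 e :=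
  travel_of_ne s e.2

theorem zero_ne_succ (i : Fin N) : (0 : Fin (N + 1)) ≠ i.succ := (Fin.succ_ne_zero i).symm

theorem succ_ne_succ_of_mem {i i' : Fin N} (h : i' ∈ univ.erase i) :
    (i.succ : Fin (N + 1)) ≠ i'.succ := fun he =>
  Finset.ne_of_mem_erase h (Fin.succ_injective _ he).symm

/-- The part of the value of a dual solution that does not depend on the scenario. -/
def scheduleTerm (a y : ℕ → ℝ) : ℝ :=
  -(a 1 * y 1) + ∑ j ∈ Icc 2 (N + 1), (a (j - 1) - a j) * y j

/-- The coefficient of the service time of customer `i` in the value of the dual solution `y`. -/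
def serviceCoef (x : Fin N → ℕ → ℝ) (y : ℕ → ℝ) (i : Fin N) : ℝ :=
  ∑ j ∈ Icc 2 (N + 1), x i (j - 1) * y j

/-- The coefficient of the travel time from `p` to `q` in the value of the dual solution `y`. -/
def arcCoef (lam : ℝ) (x : Fin N → ℕ → ℝ) (y : ℕ → ℝ) (p q : Fin (N + 1)) : ℝ :=
  Fin.cases (Fin.cases 0 (fun i => x i 1 * (y 1 + lam)) q)
    (fun i => Fin.cases (lam * x i N)
      (fun i' => ∑ j ∈ Icc 2 (N + 1), x i (j - 1) * x i' j * (y j + lam)) q) p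

theorem sum_Icc_one_eq (f : ℕ → ℝ) (n : ℕ) :
    ∑ j ∈ Icc 1 (n + 1), f j = f 1 + ∑ j ∈ Icc 2 (n + 1), f j := by
  rw [sum_Icc_one_split f (show 1 ≤ n + 1 by omega)]
  simp

theorem sum_Icc_two_succ {f : ℕ → ℝ} (hN : 1 ≤ N) (h : f (N + 1) = 0) :
    ∑ j ∈ Icc 2 (N + 1), f j = ∑ j ∈ Icc 2 N, f j := by
  rw [Finset.sum_Icc_succ_top (by omega), h, add_zero]

theorem travelTime_eq (hN : 1 ≤ N) {x : Fin N → ℕ → ℝ} (hx : x ∈ routes N) (s : Scenario N) :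
    travelTime x s = (∑ j ∈ Icc 2 (N + 1), ∑ i, ∑ i' ∈ univ.erase i,
        s.travel i.succ i'.succ * x i (j - 1) * x i' j)
      + ∑ i, (s.travel 0 i.succ * x i 1 + s.travel i.succ 0 * x i N) := by
  rw [sum_Icc_two_succ hN (by simp [hx.2.2.2]), travelTime]

/-- Regrouping by customers and arcs instead of positions exhibits the dual value as an affine
function of the scenario. -/
theorem cutValue_eq (hN : 1 ≤ N) (D : Data N) {x : Fin N → ℕ → ℝ} (hx : x ∈ routes N)
    (a : ℕ → ℝ) (s : Scenario N) (B : Finset ℕ) :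
    cutValue D x a s B = scheduleTerm (N := N) a (dualSol D B)
      + ((∑ i, s.1 i * serviceCoef x (dualSol D B) i)
        + ∑ e : Arc N, s.2 e * arcCoef D.lam x (dualSol D B) e.1.1 e.1.2) := by
  set y := dualSol D B
  have h1 : ∑ e : Arc N, s.2 e * arcCoef D.lam x y e.1.1 e.1.2
      = ∑ e : Arc N, s.travel e.1.1 e.1.2 * arcCoef D.lam x y e.1.1 e.1.2 := by
    simp_rw [travel_arc]
  have h2 : ∀ j ∈ Icc 2 (N + 1), load x a s j * y j = (a (j - 1) - a j) * y j
      + ((∑ i, s.1 i * (x i (j - 1) * y j)) + ∑ i, ∑ i' ∈ univ.erase i,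
        s.travel i.succ i'.succ * (x i (j - 1) * x i' j * y j)) := by
    intro j hj
    have := (Finset.mem_Icc.1 hj).1
    rw [load, if_neg (by omega), add_assoc, add_mul, add_mul, Finset.sum_mul, Finset.sum_mul]
    simp_rw [Finset.sum_mul]
    congr 2
    · exact Finset.sum_congr rfl fun i _ => by ring
    · exact Finset.sum_congr rfl fun i _ => Finset.sum_congr rfl fun i' _ => by ring
  have h3 : load x a s 1 * y 1 = -(a 1 * y 1) + ∑ i, s.travel 0 i.succ * (x i 1 * y 1) := by
    simp only [load, if_true, sub_mul, Finset.sum_mul]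
    have : ∑ i, s.travel 0 i.succ * x i 1 * y 1 = ∑ i, s.travel 0 i.succ * (x i 1 * y 1) :=
      Finset.sum_congr rfl fun i _ => by ring
    linarith
  have h4 : ∑ i, s.1 i * serviceCoef x y i
      = ∑ j ∈ Icc 2 (N + 1), ∑ i, s.1 i * (x i (j - 1) * y j) := by
    rw [Finset.sum_comm]
    simp_rw [serviceCoef, Finset.mul_sum]
  have h5 : ∑ i : Fin N, ∑ i' ∈ univ.erase i,
        s.travel i.succ i'.succ * arcCoef D.lam x y i.succ i'.succ
      = (∑ j ∈ Icc 2 (N + 1), ∑ i, ∑ i' ∈ univ.erase i,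
        s.travel i.succ i'.succ * (x i (j - 1) * x i' j * y j))
        + D.lam * ∑ j ∈ Icc 2 (N + 1), ∑ i, ∑ i' ∈ univ.erase i,
        s.travel i.succ i'.succ * x i (j - 1) * x i' j := by
    simp only [arcCoef, Fin.cases_succ, Finset.mul_sum]
    rw [Finset.sum_comm (s := Icc 2 (N + 1)), Finset.sum_comm (s := Icc 2 (N + 1)),
      ← Finset.sum_add_distrib]
    refine Finset.sum_congr rfl fun i _ => ?_
    rw [Finset.sum_comm (s := Icc 2 (N + 1)), Finset.sum_comm (s := Icc 2 (N + 1)),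
      ← Finset.sum_add_distrib]
    refine Finset.sum_congr rfl fun i' _ => ?_
    rw [← Finset.sum_add_distrib]
    exact Finset.sum_congr rfl fun j _ => by ring
  have h6 : ∑ i : Fin N, (s.travel 0 i.succ * arcCoef D.lam x y 0 i.succ
        + s.travel i.succ 0 * arcCoef D.lam x y i.succ 0)
      = (∑ i, s.travel 0 i.succ * (x i 1 * y 1))
        + D.lam * ∑ i, (s.travel 0 i.succ * x i 1 + s.travel i.succ 0 * x i N) := by
    rw [Finset.mul_sum, ← Finset.sum_add_distrib]
    refine Finset.sum_congr rfl fun i _ => ?_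
    simp only [arcCoef, Fin.cases_succ, Fin.cases_zero]
    ring
  rw [h1, sum_arc fun p q => s.travel p q * arcCoef D.lam x y p q, h5, h6, h4, cutValue,
    travelTime_eq hN hx, sum_Icc_one_eq, h3, Finset.sum_congr rfl h2,
    Finset.sum_add_distrib, Finset.sum_add_distrib, scheduleTerm]
  ring

theorem CostConditions.recourse_eq_sup' {D : Data N} (h : CostConditions D) {x : Fin N → ℕ → ℝ}
    (hx : x ∈ routes N) (a : ℕ → ℝ) :
    recourse D x a = ((range (N + 2)).powerset).sup' (Finset.powerset_nonempty _)
      fun B s => cutValue D x a s B := by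
  ext s
  rw [Finset.sup'_apply]
  obtain ⟨B, hB, he, -⟩ := h.exists_recourse_eq hx a s
  apply le_antisymm
  · rw [he]
    exact Finset.le_sup' (fun B => cutValue D x a s B) (Finset.mem_powerset.2 hB)
  · exact Finset.sup'_le _ _ fun B _ => h.cutValue_le_recourse hx a s B

/-! ### Integrals over the ambiguity set -/

theorem integrable_service {D : Data N} {P : Measure (Scenario N)} (hP : P ∈ ambiguitySet D)
    (i : Fin N) : Integrable (fun s : Scenario N => s.1 i) P := by
  have := hP.1
  refine Integrable.of_bound (by fun_prop) (D.dhi i) ?_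
  filter_upwards [hP.2.1] with s hs
  rw [Real.norm_of_nonneg (hs.1 i).1]
  exact (hs.1 i).2.2

theorem integrable_arc {D : Data N} {P : Measure (Scenario N)} (hP : P ∈ ambiguitySet D)
    (e : Arc N) : Integrable (fun s : Scenario N => s.2 e) P := by
  have := hP.1
  refine Integrable.of_bound (by fun_prop) (D.thi e.1.1 e.1.2) ?_
  filter_upwards [hP.2.1] with s hs
  rw [Real.norm_of_nonneg (hs.2 e).1]
  exact (hs.2 e).2.2

/-- An affine function of the scenario. -/
def affineFun (b : ℝ) (g : Fin N → ℝ) (h : Arc N → ℝ) (s : Scenario N) : ℝ :=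
  b + ((∑ i, s.1 i * g i) + ∑ e : Arc N, s.2 e * h e)

theorem integrable_affineFun {D : Data N} {P : Measure (Scenario N)} (hP : P ∈ ambiguitySet D)
    (b : ℝ) (g : Fin N → ℝ) (h : Arc N → ℝ) : Integrable (affineFun b g h) P := by
  have := hP.1
  exact (integrable_const b).add ((integrable_finsetSum _ fun i _ =>
    (integrable_service hP i).mul_const _).add (integrable_finsetSum _ fun e _ =>
    (integrable_arc hP e).mul_const _))

theorem integral_affineFun {D : Data N} {P : Measure (Scenario N)} (hP : P ∈ ambiguitySet D)
    (b : ℝ) (g : Fin N → ℝ) (h : Arc N → ℝ) :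
    ∫ s, affineFun b g h s ∂P
      = b + ((∑ i, D.meanD i * g i) + ∑ e : Arc N, D.meanT e.1.1 e.1.2 * h e) := by
  have := hP.1
  have h1 : ∀ i ∈ (univ : Finset (Fin N)), Integrable (fun s : Scenario N => s.1 i * g i) P :=
    fun i _ => (integrable_service hP i).mul_const _
  have h2 : ∀ e ∈ (univ : Finset (Arc N)), Integrable (fun s : Scenario N => s.2 e * h e) P :=
    fun e _ => (integrable_arc hP e).mul_const _
  have h3 : Integrable (fun s : Scenario N => (∑ i, s.1 i * g i) + ∑ e : Arc N, s.2 e * h e) P :=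
    (integrable_finsetSum _ h1).add (integrable_finsetSum _ h2)
  unfold affineFun
  rw [integral_add (integrable_const b) h3,
    integral_add (integrable_finsetSum _ h1) (integrable_finsetSum _ h2),
    integral_finsetSum _ h1, integral_finsetSum _ h2]
  simp_rw [integral_mul_const, hP.2.2.1, hP.2.2.2]
  simp

theorem CostConditions.integrable_recourse {D : Data N} (h : CostConditions D)
    {x : Fin N → ℕ → ℝ} (hx : x ∈ routes N) (a : ℕ → ℝ) {P : Measure (Scenario N)}
    (hP : P ∈ ambiguitySet D) : Integrable (recourse D x a) P := by
  rw [h.recourse_eq_sup' hx]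
  refine Finset.sup'_induction (p := fun f => Integrable f P) _ _
    (fun f hf g hg => hf.sup hg) fun B _ => ?_
  simp_rw [cutValue_eq h.pos D hx]
  exact integrable_affineFun hP _ _ _

/-! ### Routes -/

theorem route_binary {x : Fin N → ℕ → ℝ} (hx : x ∈ routes N) (i : Fin N) {j : ℕ}
    (hj : j ∈ Icc 1 (N + 1)) : x i j = 0 ∨ x i j = 1 := by
  obtain ⟨h1, h2⟩ := Finset.mem_Icc.1 hj
  rcases h2.lt_or_eq with h3 | rfl
  · exact hx.2.2.1 i j (Finset.mem_Icc.2 ⟨h1, by omega⟩)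
  · exact Or.inl (hx.2.2.2 i)

theorem route_nonneg {x : Fin N → ℕ → ℝ} (hx : x ∈ routes N) (i : Fin N) {j : ℕ}
    (hj : j ∈ Icc 1 (N + 1)) : 0 ≤ x i j := by
  rcases route_binary hx i hj with h | h <;> rw [h]
  exact zero_le_one

theorem exists_position {x : Fin N → ℕ → ℝ} (hx : x ∈ routes N) (i : Fin N) :
    ∃ p ∈ Icc 1 N, ∀ j ∈ Icc 1 N, x i j = if j = p then 1 else 0 := by
  have hnn : ∀ j ∈ Icc 1 N, 0 ≤ x i j := fun j hj => route_nonneg hx i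
    (Finset.mem_Icc.2 ⟨(Finset.mem_Icc.1 hj).1, (Finset.mem_Icc.1 hj).2.trans (by omega)⟩)
  have hsum := hx.2.1 i
  obtain ⟨p, hp, hp1⟩ : ∃ p ∈ Icc 1 N, x i p = 1 := by
    by_contra! hcon
    have : ∑ j ∈ Icc 1 N, x i j = 0 := Finset.sum_eq_zero fun j hj =>
      (hx.2.2.1 i j hj).resolve_right (hcon j hj)
    linarith
  refine ⟨p, hp, fun j hj => ?_⟩
  split_ifs with h
  · rw [h, hp1]
  · rw [← Finset.add_sum_erase _ _ hp, hp1] at hsum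
    have h0 : ∑ j ∈ (Icc 1 N).erase p, x i j = 0 := by linarith
    exact (Finset.sum_eq_zero_iff_of_nonneg fun j hj => hnn j (Finset.mem_of_mem_erase hj)).1 h0 j
      (Finset.mem_erase.2 ⟨h, hj⟩)

/-- The service time of `i` enters the load one position after `i` is served, and that position `q`
is unique. This collapse of sums over positions is what lets `boxMax` be applied position by
position. -/
theorem exists_successor {x : Fin N → ℕ → ℝ} (hx : x ∈ routes N) (i : Fin N) :
    ∃ q ∈ Icc 2 (N + 1), ∀ g : ℕ → ℝ, ∑ j ∈ Icc 2 (N + 1), x i (j - 1) * g j = g q := by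
  obtain ⟨p, hp, h⟩ := exists_position hx i
  obtain ⟨h1, h2⟩ := Finset.mem_Icc.1 hp
  refine ⟨p + 1, Finset.mem_Icc.2 ⟨by omega, by omega⟩, fun g => ?_⟩
  rw [Finset.sum_eq_single (p + 1)]
  · simp [h p hp]
  · intro j hj hne
    obtain ⟨h3, h4⟩ := Finset.mem_Icc.1 hj
    rw [h (j - 1) (Finset.mem_Icc.2 ⟨by omega, by omega⟩), if_neg (by omega), zero_mul]
  · intro hn
    exact absurd (Finset.mem_Icc.2 ⟨by omega, by omega⟩) hn

/-! ### The value of a position -/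

/-- The contribution of position `j` to an interval that ends at `v`: the largest value of the
corresponding part of the second-stage cost, priced by `α` and `ρ`. -/
def stageValue (D : Data N) (x : Fin N → ℕ → ℝ) (a : ℕ → ℝ) (α : Fin (N + 1) → Fin (N + 1) → ℝ)
    (ρ : Fin N → ℝ) (j v : ℕ) : ℝ :=
  if j = 1 then -(a 1 * D.pi 1 v)
    + ∑ i, x i 1 * boxMax (D.tlo 0 i.succ) (D.thi 0 i.succ) (D.pi 1 v + D.lam - α 0 i.succ)
  else if j ≤ N + 1 then (a (j - 1) - a j) * D.pi j v
    + (∑ i, ∑ i' ∈ univ.erase i, x i (j - 1) * x i' j * boxMax (D.tlo i.succ i'.succ)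
        (D.thi i.succ i'.succ) (D.pi j v + D.lam - α i.succ i'.succ))
    + ∑ i, x i (j - 1) * boxMax (D.dlo i) (D.dhi i) (D.pi j v - ρ i)
  else 0

/-- The multiplier of the travel time from `p` to `q`, which vanishes on unused arcs. -/
def arcMult (lam : ℝ) (x : Fin N → ℕ → ℝ) (α : Fin (N + 1) → Fin (N + 1) → ℝ)
    (p q : Fin (N + 1)) : ℝ :=
  Fin.cases (Fin.cases 0 (fun i => x i 1 * α 0 i.succ) q)
    (fun i => Fin.cases (lam * x i N)
      (fun i' => ∑ j ∈ Icc 2 (N + 1), x i (j - 1) * (x i' j * α i.succ i'.succ)) q) p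

theorem boxMax_mul (lo hi c : ℝ) {u : ℝ} (hu : 0 ≤ u) :
    boxMax lo hi (u * c) = u * boxMax lo hi c := by
  have : max 0 (u * c) = u * max 0 c := by
    rw [mul_max_of_nonneg _ _ hu, mul_zero]
  rw [boxMax, boxMax, this]
  ring

theorem service_boxMax {x : Fin N → ℕ → ℝ} (hx : x ∈ routes N) (y : ℕ → ℝ) (lo hi ρ : ℝ)
    (i : Fin N) :
    ∑ j ∈ Icc 2 (N + 1), x i (j - 1) * boxMax lo hi (y j - ρ)
      = boxMax lo hi (serviceCoef x y i - ρ) := by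
  obtain ⟨q, -, h⟩ := exists_successor hx i
  rw [serviceCoef, h y, h fun j => boxMax lo hi (y j - ρ)]

/-- All sums collapse to the position after `i`; the remaining factor `x i' q` is nonnegative and
passes through the positively homogeneous `boxMax`. -/
theorem arc_boxMax {x : Fin N → ℕ → ℝ} (hx : x ∈ routes N) (y : ℕ → ℝ) (lo hi lam : ℝ)
    (α : Fin (N + 1) → Fin (N + 1) → ℝ) (i i' : Fin N) :
    ∑ j ∈ Icc 2 (N + 1), x i (j - 1) * x i' j * boxMax lo hi (y j + lam - α i.succ i'.succ)
      = boxMax lo hi (arcCoef lam x y i.succ i'.succ - arcMult lam x α i.succ i'.succ) := by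
  obtain ⟨q, hq, h⟩ := exists_successor hx i
  simp only [arcCoef, arcMult, Fin.cases_succ, mul_assoc]
  rw [h fun j => x i' j * boxMax lo hi (y j + lam - α i.succ i'.succ),
    h fun j => x i' j * (y j + lam), h fun j => x i' j * α i.succ i'.succ, ← mul_sub, boxMax_mul]
  exact route_nonneg hx i' (Finset.mem_Icc.2 ⟨by have := (Finset.mem_Icc.1 hq).1; omega,
    (Finset.mem_Icc.1 hq).2⟩)

theorem first_boxMax (hN : 1 ≤ N) {x : Fin N → ℕ → ℝ} (hx : x ∈ routes N) (y : ℕ → ℝ)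
    (lo hi lam : ℝ) (α : Fin (N + 1) → Fin (N + 1) → ℝ) (i : Fin N) :
    x i 1 * boxMax lo hi (y 1 + lam - α 0 i.succ)
      = boxMax lo hi (arcCoef lam x y 0 i.succ - arcMult lam x α 0 i.succ) := by
  simp only [arcCoef, arcMult, Fin.cases_succ, Fin.cases_zero]
  rw [← mul_sub, boxMax_mul]
  exact route_nonneg hx i (Finset.mem_Icc.2 ⟨le_rfl, by omega⟩)

theorem last_boxMax (lo hi lam : ℝ) (x : Fin N → ℕ → ℝ) (y : ℕ → ℝ)
    (α : Fin (N + 1) → Fin (N + 1) → ℝ) (i : Fin N) :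
    boxMax lo hi (arcCoef lam x y i.succ 0 - arcMult lam x α i.succ 0) = 0 := by
  simp [arcCoef, arcMult, boxMax]

/-- The bridge between the two views: the right side is the box maximum of the affine function of a
partition after subtracting the multipliers, the left side splits it into positions. Return arcs to
the depot drop out because their coefficient `λ x_{i,N}` equals their multiplier. -/
theorem partitionValue_stageValue (hN : 1 ≤ N) (D : Data N) {x : Fin N → ℕ → ℝ}
    (hx : x ∈ routes N) (a : ℕ → ℝ) (α : Fin (N + 1) → Fin (N + 1) → ℝ) (ρ : Fin N → ℝ)
    (B : Finset ℕ) :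
    partitionValue (stageValue D x a α ρ) B (N + 2) = scheduleTerm (N := N) a (dualSol D B)
      + ((∑ i, boxMax (D.dlo i) (D.dhi i) (serviceCoef x (dualSol D B) i - ρ i))
        + ∑ e : Arc N, boxMax (D.tlo e.1.1 e.1.2) (D.thi e.1.1 e.1.2)
          (arcCoef D.lam x (dualSol D B) e.1.1 e.1.2 - arcMult D.lam x α e.1.1 e.1.2)) := by
  set y := dualSol D B with hy
  have hlast : stageValue D x a α ρ (N + 1 + 1) (nextBreak B (N + 2) (N + 1 + 1)) = 0 := by
    simp [stageValue]
  have hfirst : stageValue D x a α ρ 1 (nextBreak B (N + 2) 1) = -(a 1 * y 1)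
      + ∑ i, x i 1 * boxMax (D.tlo 0 i.succ) (D.thi 0 i.succ) (y 1 + D.lam - α 0 i.succ) := by
    simp [stageValue, hy, dualSol]
  have hmid : ∀ j ∈ Icc 2 (N + 1), stageValue D x a α ρ j (nextBreak B (N + 2) j)
      = (a (j - 1) - a j) * y j
      + (∑ i, ∑ i' ∈ univ.erase i, x i (j - 1) * x i' j * boxMax (D.tlo i.succ i'.succ)
        (D.thi i.succ i'.succ) (y j + D.lam - α i.succ i'.succ))
      + ∑ i, x i (j - 1) * boxMax (D.dlo i) (D.dhi i) (y j - ρ i) := by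
    intro j hj
    obtain ⟨h1, h2⟩ := Finset.mem_Icc.1 hj
    rw [stageValue, if_neg (by omega), if_pos h2]
    rfl
  have h1 : ∑ j ∈ Icc 2 (N + 1), ∑ i : Fin N,
      x i (j - 1) * boxMax (D.dlo i) (D.dhi i) (y j - ρ i)
      = ∑ i, boxMax (D.dlo i) (D.dhi i) (serviceCoef x y i - ρ i) := by
    rw [Finset.sum_comm]
    exact Finset.sum_congr rfl fun i _ => service_boxMax hx y _ _ _ i
  have h2 : ∑ j ∈ Icc 2 (N + 1), ∑ i : Fin N, ∑ i' ∈ univ.erase i, x i (j - 1) * x i' j *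
      boxMax (D.tlo i.succ i'.succ) (D.thi i.succ i'.succ) (y j + D.lam - α i.succ i'.succ)
      = ∑ i : Fin N, ∑ i' ∈ univ.erase i, boxMax (D.tlo i.succ i'.succ) (D.thi i.succ i'.succ)
        (arcCoef D.lam x y i.succ i'.succ - arcMult D.lam x α i.succ i'.succ) := by
    rw [Finset.sum_comm]
    refine Finset.sum_congr rfl fun i _ => ?_
    rw [Finset.sum_comm]
    exact Finset.sum_congr rfl fun i' _ => arc_boxMax hx y _ _ _ α i i'
  rw [sum_arc fun p q => boxMax (D.tlo p q) (D.thi p q)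
    (arcCoef D.lam x y p q - arcMult D.lam x α p q)]
  simp_rw [last_boxMax, add_zero, ← first_boxMax hN hx]
  rw [← h1, ← h2, partitionValue, Finset.sum_Icc_succ_top (by omega), hlast, sum_Icc_one_eq,
    hfirst, Finset.sum_congr rfl hmid, Finset.sum_add_distrib, Finset.sum_add_distrib,
    scheduleTerm]
  ring

theorem cutValue_le_partitionValue (hN : 1 ≤ N) (D : Data N) {x : Fin N → ℕ → ℝ}
    (hx : x ∈ routes N) (a : ℕ → ℝ) (α : Fin (N + 1) → Fin (N + 1) → ℝ) (ρ : Fin N → ℝ)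
    (B : Finset ℕ) {s : Scenario N} (hs : s ∈ support D) :
    cutValue D x a s B ≤ affineFun (partitionValue (stageValue D x a α ρ) B (N + 2)) ρ
      (fun e => arcMult D.lam x α e.1.1 e.1.2) s := by
  rw [cutValue_eq hN D hx, partitionValue_stageValue hN D hx, affineFun]
  have h1 : ∑ i, s.1 i * serviceCoef x (dualSol D B) i
      ≤ ∑ i, boxMax (D.dlo i) (D.dhi i) (serviceCoef x (dualSol D B) i - ρ i)
        + ∑ i, s.1 i * ρ i := by
    rw [← Finset.sum_add_distrib]
    refine Finset.sum_le_sum fun i _ => ?_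
    have := mul_le_boxMax (c := serviceCoef x (dualSol D B) i - ρ i) (hs.1 i).2.1 (hs.1 i).2.2
    linarith
  have h2 : ∑ e : Arc N, s.2 e * arcCoef D.lam x (dualSol D B) e.1.1 e.1.2
      ≤ ∑ e : Arc N, boxMax (D.tlo e.1.1 e.1.2) (D.thi e.1.1 e.1.2)
          (arcCoef D.lam x (dualSol D B) e.1.1 e.1.2 - arcMult D.lam x α e.1.1 e.1.2)
        + ∑ e : Arc N, s.2 e * arcMult D.lam x α e.1.1 e.1.2 := by
    rw [← Finset.sum_add_distrib]
    refine Finset.sum_le_sum fun e _ => ?_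
    have := mul_le_boxMax (c := arcCoef D.lam x (dualSol D B) e.1.1 e.1.2
      - arcMult D.lam x α e.1.1 e.1.2) (hs.2 e).2.1 (hs.2 e).2.2
    linarith
  linarith

/-! ### Exactness of the McCormick inequalities -/

/-- For `b = 0` the bounds `lo * b` and `hi * b` pinch `m`, for `b = 1` the other two do. Validity
of the bounds on `y` matters only for the converse, that is, for the constructed solution. -/
theorem mccormick_exact {lo hi y b m : ℝ} (hb : b = 0 ∨ b = 1) (h1 : lo * b ≤ m)
    (h2 : y + hi * (b - 1) ≤ m) (h3 : m ≤ hi * b) (h4 : m ≤ y + lo * (b - 1)) : m = y * b := by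
  rcases hb with rfl | rfl <;> linarith

theorem mccormick_of_eq {lo hi y b : ℝ} (hb : b = 0 ∨ b = 1) (h1 : lo ≤ y) (h2 : y ≤ hi) :
    lo * b ≤ y * b ∧ y + hi * (b - 1) ≤ y * b ∧ y * b ≤ hi * b ∧ y * b ≤ y + lo * (b - 1) := by
  rcases hb with rfl | rfl <;> refine ⟨?_, ?_, ?_, ?_⟩ <;> linarith

/-- The product variables are products. -/
structure ExactProducts (z : Var N → ℝ) : Prop where
  tau : ∀ i, ∀ i' ∈ univ.erase i, ∀ j ∈ Icc 2 (N + 1),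
    z (.tau i i' j) = z (.x i (j - 1)) * z (.x i' j)
  eta : ∀ i, ∀ i' ∈ univ.erase i, ∀ j ∈ Icc 2 (N + 1),
    z (.eta i i' j) = z (.alpha i.succ i'.succ) * z (.tau i i' j)
  psi : ∀ i, z (.psi i) = z (.alpha 0 i.succ) * z (.x i 1)
  phi : ∀ i, ∀ i' ∈ univ.erase i, ∀ j ∈ Icc 2 (N + 1), ∀ v ∈ Icc j (N + 2),
    z (.phi i i' j v) = z (.gamma i i' j v) * z (.tau i i' j)
  sigma : ∀ i, ∀ v ∈ Icc 1 (N + 2), z (.sigma i v) = z (.gamma0 i v) * z (.x i 1)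
  xi : ∀ i, ∀ j ∈ Icc 2 (N + 1), ∀ v ∈ Icc j (N + 2),
    z (.xi i j v) = z (.delta i j v) * z (.x i (j - 1))
  zeta : ∀ i, ∀ j ∈ Icc 2 (N + 1), z (.zeta i j) = z (.rho i) * z (.x i (j - 1))

theorem mem_Icc_pred {j : ℕ} (hj : j ∈ Icc 2 (N + 1)) : j - 1 ∈ Icc 1 (N + 1) := by
  obtain ⟨h1, h2⟩ := Finset.mem_Icc.1 hj
  exact Finset.mem_Icc.2 ⟨by omega, by omega⟩

theorem mem_Icc_of_two {j : ℕ} (hj : j ∈ Icc 2 (N + 1)) : j ∈ Icc 1 (N + 1) := by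
  obtain ⟨h1, h2⟩ := Finset.mem_Icc.1 hj
  exact Finset.mem_Icc.2 ⟨by omega, by omega⟩

theorem mem_Icc_one : 1 ∈ Icc 1 (N + 1) := Finset.mem_Icc.2 ⟨le_rfl, by omega⟩

theorem MILPFeasible.exactProducts {D : Data N} {B : Bounds N} {z : Var N → ℝ}
    (h : MILPFeasible D B z) : ExactProducts z := by
  have hbin : ∀ i, ∀ j ∈ Icc 1 (N + 1), z (.x i j) = 0 ∨ z (.x i j) = 1 :=
    fun i j hj => route_binary h.route i hj
  have htau : ∀ i, ∀ i' ∈ univ.erase i, ∀ j ∈ Icc 2 (N + 1),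
      z (.tau i i' j) = z (.x i (j - 1)) * z (.x i' j) := by
    intro i i' hi' j hj
    obtain ⟨h1, h2, h3, h4⟩ := h.mc_tau i i' hi' j hj
    rcases hbin i _ (mem_Icc_pred hj) with hb | hb <;>
      rcases hbin i' _ (mem_Icc_of_two hj) with hb' | hb' <;> rw [hb, hb'] at h1 <;>
      rw [hb] at h3 <;> rw [hb'] at h4 <;> rw [hb, hb'] <;> linarith
  -- Although `τ` is a continuous variable, its inequalities force it to be binary, so it can serve
  -- as the binary factor of further products.
  have htb : ∀ i, ∀ i' ∈ univ.erase i, ∀ j ∈ Icc 2 (N + 1),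
      z (.tau i i' j) = 0 ∨ z (.tau i i' j) = 1 := by
    intro i i' hi' j hj
    rw [htau i i' hi' j hj]
    rcases hbin i _ (mem_Icc_pred hj) with hb | hb <;>
      rcases hbin i' _ (mem_Icc_of_two hj) with hb' | hb' <;> simp [hb, hb']
  refine ⟨htau, ?_, ?_, ?_, ?_, ?_, ?_⟩
  · intro i i' hi' j hj
    obtain ⟨h1, h2, h3, h4⟩ := h.mc_eta i i' hi' j hj
    exact mccormick_exact (htb i i' hi' j hj) h1 h2 h3 h4
  · intro i
    obtain ⟨h1, h2, h3, h4⟩ := h.mc_psi i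
    exact mccormick_exact (hbin i 1 mem_Icc_one) h1 h2 h3 h4
  · intro i i' hi' j hj v hv
    obtain ⟨h1, h2, h3, h4⟩ := h.mc_phi i i' hi' j hj v hv
    exact mccormick_exact (lo := 0) (htb i i' hi' j hj) (by simpa using h2) h1 h3 (by simpa using h4)
  · intro i v hv
    obtain ⟨h1, h2, h3, h4⟩ := h.mc_sigma i v hv
    exact mccormick_exact (lo := 0) (hbin i 1 mem_Icc_one) (by simpa using h2) h1 h3
      (by simpa using h4)
  · intro i j hj v hv
    obtain ⟨h1, h2, h3, h4⟩ := h.mc_xi i j hj v hv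
    exact mccormick_exact (lo := 0) (hbin i _ (mem_Icc_pred hj)) (by simpa using h2) h1 h4
      (by simpa using h3)
  · intro i j hj
    obtain ⟨h1, h2, h3, h4⟩ := h.mc_zeta i j hj
    exact mccormick_exact (hbin i _ (mem_Icc_pred hj)) h1 h2 h3 h4

/-! ### The `β`-constraints and the objective in terms of stage values -/

/-- The arguments of `stageValue` read off from a solution of the program. -/
def stageOf (D : Data N) (z : Var N → ℝ) : ℕ → ℕ → ℝ :=
  stageValue D (fun i j => z (.x i j)) (fun j => z (.a j)) (fun p q => z (.alpha p q))
    fun i => z (.rho i)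

/-- The artificial position `N + 2` has stage value zero, which accounts for the upper limit `min v
(N + 1)` in the program. -/
theorem sum_stageOf_min (D : Data N) (z : Var N → ℝ) (k v : ℕ) :
    ∑ j ∈ Icc k v, stageOf D z j v = ∑ j ∈ Icc k (min v (N + 1)), stageOf D z j v := by
  symm
  apply Finset.sum_subset
  · intro j hj
    rw [Finset.mem_Icc] at hj ⊢
    omega
  · intro j hj hj'
    rw [Finset.mem_Icc] at hj hj'
    rw [stageOf, stageValue, if_neg (by omega), if_neg (by omega)]

/-- `startTerm` in terms of `γ`. -/
theorem startTerm_eq (D : Data N) {z : Var N → ℝ} (h : ExactProducts z) {v : ℕ}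
    (hv : v ∈ Icc 1 (N + 2)) :
    startTerm D z v = -(z (.a 1) * D.pi 1 v) + ∑ i : Fin N, z (.x i 1)
      * (D.tlo 0 i.succ * (D.pi 1 v + D.lam - z (.alpha 0 i.succ))
        + (D.thi 0 i.succ - D.tlo 0 i.succ) * z (.gamma0 i v)) := by
  unfold startTerm Data.deltaT
  congr 1
  refine Finset.sum_congr rfl fun i _ => ?_
  rw [h.psi, h.sigma i v hv]
  ring

/-- `blockTerm` in terms of `γ` and `δ`. -/
theorem blockTerm_eq (D : Data N) {z : Var N → ℝ} (h : ExactProducts z) {k v : ℕ} (hk : 2 ≤ k)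
    (hv : v ≤ N + 2) :
    blockTerm D z k v = ∑ j ∈ Icc k (min v (N + 1)), ((z (.a (j - 1)) - z (.a j)) * D.pi j v
      + (∑ i : Fin N, ∑ i' ∈ univ.erase i, z (.x i (j - 1)) * z (.x i' j)
        * (D.tlo i.succ i'.succ * (D.pi j v + D.lam - z (.alpha i.succ i'.succ))
          + (D.thi i.succ i'.succ - D.tlo i.succ i'.succ) * z (.gamma i i' j v)))
      + ∑ i : Fin N, z (.x i (j - 1)) * (D.dlo i * (D.pi j v - z (.rho i))
          + (D.dhi i - D.dlo i) * z (.delta i j v))) := by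
  unfold blockTerm Data.deltaT Data.deltaD
  rw [← Finset.sum_add_distrib, ← Finset.sum_add_distrib]
  refine Finset.sum_congr rfl fun j hj => ?_
  rw [Finset.mem_Icc] at hj
  have hj' : j ∈ Icc 2 (N + 1) := Finset.mem_Icc.2 ⟨by omega, by omega⟩
  have hv' : v ∈ Icc j (N + 2) := Finset.mem_Icc.2 ⟨by omega, by omega⟩
  congr 1
  · congr 1
    refine Finset.sum_congr rfl fun i _ => Finset.sum_congr rfl fun i' hi' => ?_
    rw [h.eta i i' hi' j hj', h.phi i i' hi' j hj' v hv', h.tau i i' hi' j hj']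
    ring
  · refine Finset.sum_congr rfl fun i _ => ?_
    rw [h.zeta i j hj', h.xi i j hj' v hv']
    ring

/-- The hypotheses on the supports and the means. -/
structure SupportConditions (D : Data N) : Prop where
  service : ∀ i, 0 ≤ D.dlo i ∧ D.dlo i ≤ D.meanD i ∧ D.meanD i ≤ D.dhi i
  travel : ∀ p q, p ≠ q → 0 ≤ D.tlo p q ∧ D.tlo p q ≤ D.meanT p q ∧ D.meanT p q ≤ D.thi p q

/-- In a feasible point `γ` and `δ` only dominate the positive parts; as `hi - lo ≥ 0`, the terms of
the `β`-constraints then dominate the stage values. -/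
theorem boxMax_le {lo hi c g : ℝ} (h : lo ≤ hi) (h0 : 0 ≤ g) (h1 : c ≤ g) :
    boxMax lo hi c ≤ lo * c + (hi - lo) * g :=
  add_le_add le_rfl (mul_le_mul_of_nonneg_left (max_le h0 h1) (sub_nonneg.2 h))

theorem SupportConditions.tlo_le_thi {D : Data N} (hD : SupportConditions D) {p q : Fin (N + 1)}
    (h : p ≠ q) : D.tlo p q ≤ D.thi p q := (hD.travel p q h).2.1.trans (hD.travel p q h).2.2

theorem SupportConditions.dlo_le_dhi {D : Data N} (hD : SupportConditions D) (i : Fin N) :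
    D.dlo i ≤ D.dhi i := (hD.service i).2.1.trans (hD.service i).2.2

theorem MILPFeasible.stageOf_one_le {D : Data N} (hD : SupportConditions D) {B : Bounds N}
    {z : Var N → ℝ} (h : MILPFeasible D B z) {v : ℕ} (hv : v ∈ Icc 1 (N + 2)) :
    stageOf D z 1 v ≤ startTerm D z v := by
  rw [startTerm_eq D h.exactProducts hv, stageOf, stageValue, if_pos rfl]
  refine add_le_add le_rfl (Finset.sum_le_sum fun i _ => ?_)
  exact mul_le_mul_of_nonneg_left (boxMax_le (hD.tlo_le_thi (zero_ne_succ i))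
    (h.gamma0_ge i v hv).1 (h.gamma0_ge i v hv).2) (route_nonneg h.route i mem_Icc_one)

theorem MILPFeasible.sum_stageOf_le {D : Data N} (hD : SupportConditions D) {B : Bounds N}
    {z : Var N → ℝ} (h : MILPFeasible D B z) {k v : ℕ} (hk : 2 ≤ k) (hv : v ≤ N + 2) :
    ∑ j ∈ Icc k v, stageOf D z j v ≤ blockTerm D z k v := by
  rw [blockTerm_eq D h.exactProducts hk hv, sum_stageOf_min D z]
  refine Finset.sum_le_sum fun j hj => ?_
  rw [Finset.mem_Icc] at hj
  have hj' : j ∈ Icc 2 (N + 1) := Finset.mem_Icc.2 ⟨by omega, by omega⟩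
  have hv' : v ∈ Icc j (N + 2) := Finset.mem_Icc.2 ⟨by omega, by omega⟩
  rw [stageOf, stageValue, if_neg (by omega), if_pos (by omega)]
  refine add_le_add (add_le_add le_rfl (Finset.sum_le_sum fun i _ =>
    Finset.sum_le_sum fun i' hi' => ?_)) (Finset.sum_le_sum fun i _ => ?_)
  · exact mul_le_mul_of_nonneg_left (boxMax_le (hD.tlo_le_thi (succ_ne_succ_of_mem hi'))
      (h.gamma_ge i i' hi' j hj' v hv').1 (h.gamma_ge i i' hi' j hj' v hv').2)
      (mul_nonneg (route_nonneg h.route i (mem_Icc_pred hj'))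
        (route_nonneg h.route i' (mem_Icc_of_two hj')))
  · exact mul_le_mul_of_nonneg_left (boxMax_le (hD.dlo_le_dhi i)
      (h.delta_ge i j hj' v hv').1 (h.delta_ge i j hj' v hv').2)
      (route_nonneg h.route i (mem_Icc_pred hj'))

/-- The four kinds of `β`-constraints together cover all intervals: `[1, 1]`, `[1, v]`, `[k, v]`
with `2 ≤ k ≤ N + 1`, and the last one `[N + 2, N + 2]`, whose value is zero. -/
theorem MILPFeasible.interval_le {D : Data N} (hD : SupportConditions D) {B : Bounds N}
    {z : Var N → ℝ} (h : MILPFeasible D B z) (k v : ℕ) (h1 : 1 ≤ k) (h2 : k ≤ v)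
    (h3 : v ≤ N + 2) : ∑ j ∈ Icc k v, stageOf D z j v ≤ ∑ j ∈ Icc k v, z (.beta j) := by
  rcases h1.lt_or_eq with hk | rfl
  · rcases Nat.lt_or_ge k (N + 2) with hk' | hk'
    · exact (h.sum_stageOf_le hD hk h3).trans (h.beta_block k (Finset.mem_Icc.2 ⟨hk, by omega⟩) v
        (Finset.mem_Icc.2 ⟨h2, h3⟩))
    · obtain rfl : k = N + 2 := by omega
      obtain rfl : v = N + 2 := by omega
      simpa [stageOf, stageValue] using h.beta_last
  · have hs := h.stageOf_one_le hD (Finset.mem_Icc.2 ⟨h2, h3⟩)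
    rcases h2.lt_or_eq with hv | rfl
    · obtain ⟨v, rfl⟩ := Nat.exists_eq_add_of_le' (show 1 ≤ v by omega)
      rw [sum_Icc_one_eq fun j => stageOf D z j (v + 1)]
      exact (add_le_add hs (h.sum_stageOf_le hD le_rfl h3)).trans
        (h.beta_start (v + 1) (Finset.mem_Icc.2 ⟨hv, h3⟩))
    · simpa using hs.trans h.beta_first

/-- The objective is that of the dual moment problem: the potentials plus the means paired with the
multipliers. -/
theorem milpObj_eq (hN : 1 ≤ N) (D : Data N) {z : Var N → ℝ} (h : ExactProducts z)
    (hz : ∀ i, z (.x i (N + 1)) = 0) :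
    milpObj D z = ∑ j ∈ Icc 1 (N + 2), z (.beta j) + ((∑ i, D.meanD i * z (.rho i))
      + ∑ e : Arc N, D.meanT e.1.1 e.1.2
        * arcMult D.lam (fun i j => z (.x i j)) (fun p q => z (.alpha p q)) e.1.1 e.1.2) := by
  rw [sum_arc fun p q => D.meanT p q
    * arcMult D.lam (fun i j => z (.x i j)) (fun p q => z (.alpha p q)) p q]
  have h1 : ∑ j ∈ Icc 2 N, ∑ i : Fin N, ∑ i' ∈ univ.erase i,
      D.meanT i.succ i'.succ * z (.eta i i' j)
      = ∑ i : Fin N, ∑ i' ∈ univ.erase i, D.meanT i.succ i'.succ *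
        arcMult D.lam (fun i j => z (.x i j)) (fun p q => z (.alpha p q)) i.succ i'.succ := by
    -- The term `j = N + 1` may be added, since `x_{i',N+1} = 0` makes the corresponding `η` vanish.
    rw [← sum_Icc_two_succ hN, Finset.sum_comm]
    · refine Finset.sum_congr rfl fun i _ => ?_
      rw [Finset.sum_comm]
      refine Finset.sum_congr rfl fun i' hi' => ?_
      simp only [arcMult, Fin.cases_succ, Finset.mul_sum]
      refine Finset.sum_congr rfl fun j hj => ?_
      rw [h.eta i i' hi' j hj, h.tau i i' hi' j hj]
      ring
    · refine Finset.sum_eq_zero fun i _ => Finset.sum_eq_zero fun i' hi' => ?_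
      have hj : N + 1 ∈ Icc 2 (N + 1) := Finset.mem_Icc.2 ⟨by omega, le_rfl⟩
      rw [h.eta i i' hi' _ hj, h.tau i i' hi' _ hj, hz i']
      ring
  have h2 : ∑ i : Fin N, (D.meanT 0 i.succ
      * arcMult D.lam (fun i j => z (.x i j)) (fun p q => z (.alpha p q)) 0 i.succ
      + D.meanT i.succ 0
      * arcMult D.lam (fun i j => z (.x i j)) (fun p q => z (.alpha p q)) i.succ 0)
      = D.lam * (∑ i, D.meanT i.succ 0 * z (.x i N)) + ∑ i, D.meanT 0 i.succ * z (.psi i) := by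
    rw [Finset.mul_sum, ← Finset.sum_add_distrib]
    refine Finset.sum_congr rfl fun i _ => ?_
    simp only [arcMult, Fin.cases_succ, Fin.cases_zero]
    rw [h.psi]
    ring
  rw [milpObj, h1, h2]
  ring

/-- Every feasible solution of the program bounds the expected costs from above. -/
theorem CostConditions.integral_recourse_le {D : Data N} (hC : CostConditions D)
    (hD : SupportConditions D) {B : Bounds N} {z : Var N → ℝ} (h : MILPFeasible D B z)
    {P : Measure (Scenario N)} (hP : P ∈ ambiguitySet D) :
    ∫ s, recourse D (fun i j => z (.x i j)) (fun j => z (.a j)) s ∂P ≤ milpObj D z := by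
  rw [milpObj_eq hC.pos D h.exactProducts h.route.2.2.2, ← integral_affineFun hP]
  refine integral_mono_ae (hC.integrable_recourse h.route _ hP) (integrable_affineFun hP _ _ _) ?_
  filter_upwards [hP.2.1] with s hs
  obtain ⟨C, hsub, he, -⟩ := hC.exists_recourse_eq h.route (fun j => z (.a j)) s
  rw [he]
  refine (cutValue_le_partitionValue hC.pos D h.route _ (fun p q => z (.alpha p q))
    (fun i => z (.rho i)) C hs).trans ?_
  exact add_le_add (partitionValue_le_sum (h.interval_le hD) (N + 2) le_rfl hsub) le_rfl

/-! ### Finitely supported distributions -/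

/-- The distribution with mass `p k` at `ξ k`. -/
def discrete {ι : Type*} [Fintype ι] (p : ι → ℝ) (ξ : ι → Scenario N) : Measure (Scenario N) :=
  ∑ k, ENNReal.ofReal (p k) • Measure.dirac (ξ k)

theorem integral_discrete {ι : Type*} [Fintype ι] {p : ι → ℝ} (hp : ∀ k, 0 ≤ p k)
    (ξ : ι → Scenario N) (g : Scenario N → ℝ) :
    ∫ s, g s ∂(discrete p ξ) = ∑ k, p k * g (ξ k) := by
  unfold discrete
  rw [integral_finsetSum_measure]
  · refine Finset.sum_congr rfl fun k _ => ?_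
    rw [integral_smul_measure, integral_dirac, ENNReal.toReal_ofReal (hp k), smul_eq_mul]
  · intro k _
    exact (integrable_dirac (by simp)).smul_measure ENNReal.ofReal_ne_top

theorem discrete_mem_ambiguitySet {ι : Type*} [Fintype ι] {D : Data N} {p : ι → ℝ}
    (hp : p ∈ stdSimplex ℝ ι) {ξ : ι → Scenario N} (hξ : ∀ k, ξ k ∈ support D)
    (hmean : ∀ i, ∑ k, p k * (ξ k).1 i = D.meanD i)
    (hmeanT : ∀ e : Arc N, ∑ k, p k * (ξ k).2 e = D.meanT e.1.1 e.1.2) :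
    discrete p ξ ∈ ambiguitySet D := by
  refine ⟨⟨?_⟩, ?_, ?_, ?_⟩
  · simp only [discrete, Measure.coe_finsetSum, Finset.sum_apply, Measure.smul_apply,
      measure_univ, smul_eq_mul, mul_one]
    rw [← ENNReal.ofReal_sum_of_nonneg fun k _ => hp.1 k, hp.2, ENNReal.ofReal_one]
  · unfold discrete
    rw [ae_finsetSum_measure_iff]
    intro k _
    refine Measure.ae_smul_measure ?_ _
    simpa [ae_dirac_eq] using hξ k
  · intro i
    rw [integral_discrete hp.1, hmean]
  · intro e
    rw [integral_discrete hp.1, hmeanT]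

/-! ### Bounds on the multipliers -/

theorem finite_piValues1 (D : Data N) : D.piValues1.Finite := by
  refine ((Icc 2 (N + 1) ×ˢ Icc 0 (N + 2)).image fun q => D.pi q.1 q.2).finite_toSet.subset ?_
  rintro _ ⟨j, hj, v, hv, rfl⟩
  simp only [Finset.coe_image, Set.mem_image, Finset.mem_coe, Finset.mem_product]
  exact ⟨(j, v), ⟨hj, Finset.mem_Icc.2 ⟨by omega, (Finset.mem_Icc.1 hv).2⟩⟩, rfl⟩

theorem finite_piValues2 (D : Data N) : D.piValues2.Finite := by
  refine ((Icc 1 (N + 2)).image fun v => D.pi 1 v).finite_toSet.subset ?_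
  rintro _ ⟨v, hv, rfl⟩
  simp only [Finset.coe_image, Set.mem_image, Finset.mem_coe]
  exact ⟨v, hv, rfl⟩

theorem P1_bounds (D : Data N) {j v : ℕ} (hj : j ∈ Icc 2 (N + 1)) (hv : v ∈ Icc j (N + 2)) :
    D.P1l ≤ D.pi j v ∧ D.pi j v ≤ D.P1u :=
  ⟨csInf_le (finite_piValues1 D).bddBelow ⟨j, hj, v, hv, rfl⟩,
    le_csSup (finite_piValues1 D).bddAbove ⟨j, hj, v, hv, rfl⟩⟩

theorem P2_bounds (D : Data N) {v : ℕ} (hv : v ∈ Icc 1 (N + 2)) :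
    D.P2l ≤ D.pi 1 v ∧ D.pi 1 v ≤ D.P2u :=
  ⟨csInf_le (finite_piValues2 D).bddBelow ⟨v, hv, rfl⟩,
    le_csSup (finite_piValues2 D).bddAbove ⟨v, hv, rfl⟩⟩

theorem P1_dualSol (D : Data N) (B : Finset ℕ) {j : ℕ} (hj : j ∈ Icc 2 (N + 1)) :
    D.P1l ≤ dualSol D B j ∧ dualSol D B j ≤ D.P1u := by
  have h : j ≤ N + 2 := (Finset.mem_Icc.1 hj).2.trans (by omega)
  exact P1_bounds D hj (Finset.mem_Icc.2 ⟨(nextBreak_mem B h).1, nextBreak_le B h⟩)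

theorem P2_dualSol (D : Data N) (B : Finset ℕ) :
    D.P2l ≤ dualSol D B 1 ∧ dualSol D B 1 ≤ D.P2u := by
  have h : 1 ≤ N + 2 := by omega
  exact P2_bounds D (Finset.mem_Icc.2 ⟨(nextBreak_mem B h).1, nextBreak_le B h⟩)

/-- The range of the coefficients of the travel times from `p` on used arcs. -/
def alphaMin (D : Data N) (p _q : Fin (N + 1)) : ℝ := if p = 0 then D.P2l + D.lam else D.P1l + D.lam
def alphaMax (D : Data N) (p _q : Fin (N + 1)) : ℝ := if p = 0 then D.P2u + D.lam else D.P1u + D.lam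

theorem alphaMin_le_alphaMax (hN : 1 ≤ N) (D : Data N) (p q : Fin (N + 1)) :
    alphaMin D p q ≤ alphaMax D p q := by
  unfold alphaMin alphaMax
  split_ifs
  · have := P2_dualSol D ∅
    linarith
  · have := P1_dualSol D ∅ (j := 2) (Finset.mem_Icc.2 ⟨le_rfl, by omega⟩)
    linarith

theorem arcMult_const (lam : ℝ) (x : Fin N → ℕ → ℝ) (α : Fin (N + 1) → Fin (N + 1) → ℝ)
    (p q : Fin (N + 1)) : arcMult lam x (fun _ _ => α p q) p q = arcMult lam x α p q := by
  refine Fin.cases ?_ (fun i => ?_) p <;> refine Fin.cases ?_ (fun i' => ?_) q <;> rfl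

/-- The moment problem yields multipliers of arcs, the program wants prices `α`. On each arc the
multiplier depends continuously on `α p q` alone, so the intermediate value theorem gives a price in
the range, without distinguishing used from unused arcs. -/
theorem exists_alpha (hN : 1 ≤ N) (D : Data N) (x : Fin N → ℕ → ℝ) (θ : Arc N → ℝ)
    (hθ : ∀ e : Arc N, arcMult D.lam x (alphaMin D) e.1.1 e.1.2 ≤ θ e ∧
      θ e ≤ arcMult D.lam x (alphaMax D) e.1.1 e.1.2) :
    ∃ α : Fin (N + 1) → Fin (N + 1) → ℝ, (∀ p q, alphaMin D p q ≤ α p q ∧ α p q ≤ alphaMax D p q) ∧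
      ∀ e : Arc N, arcMult D.lam x α e.1.1 e.1.2 = θ e := by
  have key : ∀ p q, ∃ r, (alphaMin D p q ≤ r ∧ r ≤ alphaMax D p q) ∧
      ∀ h : p ≠ q, arcMult D.lam x (fun _ _ => r) p q = θ ⟨(p, q), h⟩ := by
    intro p q
    by_cases h : p = q
    · exact ⟨alphaMin D p q, ⟨le_rfl, alphaMin_le_alphaMax hN D p q⟩, fun h' => absurd h h'⟩
    · have hc : Continuous fun r : ℝ => arcMult D.lam x (fun _ _ => r) p q := by
        refine Fin.cases ?_ (fun i => ?_) p <;> refine Fin.cases ?_ (fun i' => ?_) q <;>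
          simp only [arcMult, Fin.cases_zero, Fin.cases_succ] <;> fun_prop
      have hmem := hθ ⟨(p, q), h⟩
      simp only [← arcMult_const D.lam x (alphaMin D), ← arcMult_const D.lam x (alphaMax D)] at hmem
      obtain ⟨r, hr, hr'⟩ := intermediate_value_Icc (alphaMin_le_alphaMax hN D p q)
        hc.continuousOn hmem
      exact ⟨r, hr, fun _ => hr'⟩
  choose α hα hα' using key
  refine ⟨α, hα, fun e => ?_⟩
  rw [← arcMult_const, hα' _ _ e.2]

theorem serviceCoef_bounds (D : Data N) {x : Fin N → ℕ → ℝ} (hx : x ∈ routes N) (B : Finset ℕ)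
    (i : Fin N) :
    D.P1l ≤ serviceCoef x (dualSol D B) i ∧ serviceCoef x (dualSol D B) i ≤ D.P1u := by
  obtain ⟨q, hq, h⟩ := exists_successor hx i
  rw [serviceCoef, h]
  exact P1_dualSol D B hq

theorem arcCoef_bounds (D : Data N) {x : Fin N → ℕ → ℝ} (hx : x ∈ routes N)
    (B : Finset ℕ) (p q : Fin (N + 1)) :
    arcMult D.lam x (alphaMin D) p q ≤ arcCoef D.lam x (dualSol D B) p q ∧
      arcCoef D.lam x (dualSol D B) p q ≤ arcMult D.lam x (alphaMax D) p q := by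
  have h2 := P2_dualSol D B
  refine Fin.cases ?_ (fun i => ?_) p <;> refine Fin.cases ?_ (fun i' => ?_) q <;>
    simp only [arcMult, arcCoef, Fin.cases_zero, Fin.cases_succ, alphaMin, alphaMax, if_true,
      Fin.succ_ne_zero, if_false, le_refl, and_self]
  · have h0 := route_nonneg hx i' (mem_Icc_one (N := N))
    exact ⟨mul_le_mul_of_nonneg_left (by linarith) h0, mul_le_mul_of_nonneg_left (by linarith) h0⟩
  · simp only [mul_assoc]
    constructor <;> refine Finset.sum_le_sum fun j hj => mul_le_mul_of_nonneg_left
      (mul_le_mul_of_nonneg_left ?_ (route_nonneg hx i' (mem_Icc_of_two hj)))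
      (route_nonneg hx i (mem_Icc_pred hj)) <;> have := P1_dualSol D B hj <;> linarith

/-! ### An optimal solution of the program at a given first-stage decision -/

/-- The solution of the program determined by the multipliers `α` and `ρ`. -/
def solution (D : Data N) (x : Fin N → ℕ → ℝ) (a : ℕ → ℝ) (α : Fin (N + 1) → Fin (N + 1) → ℝ)
    (ρ : Fin N → ℝ) : Var N → ℝ
  | .x i j => x i j
  | .a j => a j
  | .alpha p q => α p q
  | .rho i => ρ i
  | .beta j => bestPartition (stageValue D x a α ρ) j - bestPartition (stageValue D x a α ρ) (j - 1)
  | .gamma0 i v => max 0 (D.pi 1 v + D.lam - α 0 i.succ)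
  | .gamma i i' j v => max 0 (D.pi j v + D.lam - α i.succ i'.succ)
  | .delta i j v => max 0 (D.pi j v - ρ i)
  | .tau i i' j => x i (j - 1) * x i' j
  | .eta i i' j => α i.succ i'.succ * (x i (j - 1) * x i' j)
  | .psi i => α 0 i.succ * x i 1
  | .phi i i' j v => max 0 (D.pi j v + D.lam - α i.succ i'.succ) * (x i (j - 1) * x i' j)
  | .sigma i v => max 0 (D.pi 1 v + D.lam - α 0 i.succ) * x i 1
  | .xi i j v => max 0 (D.pi j v - ρ i) * x i (j - 1)
  | .zeta i j => ρ i * x i (j - 1)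

theorem exactProducts_solution (D : Data N) (x : Fin N → ℕ → ℝ) (a : ℕ → ℝ)
    (α : Fin (N + 1) → Fin (N + 1) → ℝ) (ρ : Fin N → ℝ) :
    ExactProducts (solution D x a α ρ) :=
  ⟨fun _ _ _ _ _ => rfl, fun _ _ _ _ _ => rfl, fun _ => rfl, fun _ _ _ _ _ _ _ => rfl,
    fun _ _ _ => rfl, fun _ _ _ _ _ => rfl, fun _ _ _ => rfl⟩

theorem stageOf_solution (D : Data N) (x : Fin N → ℕ → ℝ) (a : ℕ → ℝ)
    (α : Fin (N + 1) → Fin (N + 1) → ℝ) (ρ : Fin N → ℝ) :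
    stageOf D (solution D x a α ρ) = stageValue D x a α ρ := rfl

theorem startTerm_solution (D : Data N) (x : Fin N → ℕ → ℝ) (a : ℕ → ℝ)
    (α : Fin (N + 1) → Fin (N + 1) → ℝ) (ρ : Fin N → ℝ) {v : ℕ} (hv : v ∈ Icc 1 (N + 2)) :
    startTerm D (solution D x a α ρ) v = stageValue D x a α ρ 1 v := by
  rw [startTerm_eq D (exactProducts_solution D x a α ρ) hv, stageValue, if_pos rfl]
  rfl

theorem blockTerm_solution (D : Data N) (x : Fin N → ℕ → ℝ) (a : ℕ → ℝ)
    (α : Fin (N + 1) → Fin (N + 1) → ℝ) (ρ : Fin N → ℝ) {k v : ℕ} (hk : 2 ≤ k)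
    (hv : v ≤ N + 2) :
    blockTerm D (solution D x a α ρ) k v = ∑ j ∈ Icc k v, stageValue D x a α ρ j v := by
  rw [blockTerm_eq D (exactProducts_solution D x a α ρ) hk hv, ← stageOf_solution,
    sum_stageOf_min D (solution D x a α ρ)]
  refine Finset.sum_congr rfl fun j hj => ?_
  rw [Finset.mem_Icc] at hj
  rw [stageOf, stageValue, if_neg (by omega), if_pos (by omega)]
  rfl

/-- The `β`-constraints are Bellman's inequality for `bestPartition`. The McCormick inequalities
need only that each factor lies within its bounds; the prices lie in `[P^l + λ, P^u + λ]`, which the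
tight bounds contain because `λ ≥ 0`. -/
theorem solution_feasible {D : Data N} (hlam : 0 ≤ D.lam) {B : Bounds N}
    (hB : B.Wider (tightBounds D)) {x : Fin N → ℕ → ℝ} (hx : x ∈ routes N) {a : ℕ → ℝ}
    (ha : a ∈ schedules D) {α : Fin (N + 1) → Fin (N + 1) → ℝ} {ρ : Fin N → ℝ}
    (hα : ∀ p q, alphaMin D p q ≤ α p q ∧ α p q ≤ alphaMax D p q)
    (hρ : ∀ i, D.P1l ≤ ρ i ∧ ρ i ≤ D.P1u) : MILPFeasible D B (solution D x a α ρ) := by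
  have hα0 : ∀ i : Fin N, D.P2l + D.lam ≤ α 0 i.succ ∧ α 0 i.succ ≤ D.P2u + D.lam := fun i => by
    simpa [alphaMin, alphaMax] using hα 0 i.succ
  have hα1 : ∀ i i' : Fin N, D.P1l + D.lam ≤ α i.succ i'.succ ∧
      α i.succ i'.succ ≤ D.P1u + D.lam := fun i i' => by
    simpa [alphaMin, alphaMax] using hα i.succ i'.succ
  have hα0B : ∀ i : Fin N, B.alphaLo 0 i.succ ≤ α 0 i.succ ∧ α 0 i.succ ≤ B.alphaHi 0 i.succ := by
    intro i
    have h1 := hB.alphaLo 0 i.succ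
    have h2 := hB.alphaHi 0 i.succ
    simp only [tightBounds, if_true] at h1 h2
    constructor <;> linarith [(hα0 i).1, (hα0 i).2]
  have hα1B : ∀ i i' : Fin N, B.alphaLo i.succ i'.succ ≤ α i.succ i'.succ ∧
      α i.succ i'.succ ≤ B.alphaHi i.succ i'.succ := by
    intro i i'
    have h1 := hB.alphaLo i.succ i'.succ
    have h2 := hB.alphaHi i.succ i'.succ
    simp only [tightBounds, Fin.succ_ne_zero, if_false] at h1 h2
    constructor <;> linarith [(hα1 i i').1, (hα1 i i').2]
  have hbin : ∀ i, ∀ j ∈ Icc 1 (N + 1), x i j = 0 ∨ x i j = 1 := fun i j hj => route_binary hx i hj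
  have htau : ∀ i i', ∀ j ∈ Icc 2 (N + 1),
      x i (j - 1) * x i' j = 0 ∨ x i (j - 1) * x i' j = 1 := by
    intro i i' j hj
    rcases hbin i _ (mem_Icc_pred hj) with hb | hb <;>
      rcases hbin i' _ (mem_Icc_of_two hj) with hb' | hb' <;> simp [hb, hb']
  have hgap : ∀ k v, 1 ≤ k → k ≤ v → ∑ j ∈ Icc k v, stageValue D x a α ρ j v
      ≤ ∑ j ∈ Icc k v, solution D x a α ρ (.beta j) :=
    fun k v h1 h2 => sum_le_bestPartition_sub _ h1 h2
  refine ⟨hx, ha, ?_, ?_, ?_, ?_, ?_, ?_, ?_, ?_, ?_, ?_, ?_, ?_, ?_, ?_⟩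
  · rw [startTerm_solution D x a α ρ (Finset.mem_Icc.2 ⟨le_rfl, by omega⟩)]
    simpa using hgap 1 1 le_rfl le_rfl
  · intro v hv
    obtain ⟨h1, h2⟩ := Finset.mem_Icc.1 hv
    rw [startTerm_solution D x a α ρ (Finset.mem_Icc.2 ⟨by omega, h2⟩),
      blockTerm_solution D x a α ρ le_rfl h2]
    refine le_trans (le_of_eq ?_) (hgap 1 v le_rfl (by omega))
    obtain ⟨v, rfl⟩ := Nat.exists_eq_add_of_le' (show 1 ≤ v by omega)
    rw [sum_Icc_one_eq fun j => stageValue D x a α ρ j (v + 1)]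
  · intro k hk v hv
    obtain ⟨h1, h2⟩ := Finset.mem_Icc.1 hv
    have h3 := (Finset.mem_Icc.1 hk).1
    rw [blockTerm_solution D x a α ρ h3 h2]
    exact hgap k v (by omega) h1
  · have := hgap (N + 2) (N + 2) (by omega) le_rfl
    simpa [stageValue] using this
  · exact fun i v _ => ⟨le_max_left _ _, le_max_right _ _⟩
  · exact fun i i' _ j _ v _ => ⟨le_max_left _ _, le_max_right _ _⟩
  · exact fun i j _ v _ => ⟨le_max_left _ _, le_max_right _ _⟩
  · intro i i' _ j hj
    simp only [solution]
    rcases hbin i _ (mem_Icc_pred hj) with hb | hb <;>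
      rcases hbin i' _ (mem_Icc_of_two hj) with hb' | hb' <;> rw [hb, hb'] <;> norm_num
  · exact fun i i' _ j hj => mccormick_of_eq (htau i i' j hj) (hα1B i i').1 (hα1B i i').2
  · exact fun i => mccormick_of_eq (hbin i 1 mem_Icc_one) (hα0B i).1 (hα0B i).2
  · intro i i' _ j hj v hv
    have h0 := hB.gammaHi i i' j v
    have h1 := P1_bounds D hj hv
    have h2 := hα1 i i'
    simp only [tightBounds] at h0
    have h3 := mccormick_of_eq (lo := 0) (hi := B.gammaHi i i' j v) (htau i i' j hj)
      (le_max_left 0 (D.pi j v + D.lam - α i.succ i'.succ))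
      (max_le (by linarith) (by linarith))
    rw [zero_mul, zero_mul, add_zero] at h3
    exact ⟨h3.2.1, h3.1, h3.2.2.1, h3.2.2.2⟩
  · intro i v hv
    have h0 := hB.gamma0Hi i v
    have h1 := P2_bounds D hv
    have h2 := hα0 i
    simp only [tightBounds] at h0
    have h3 := mccormick_of_eq (lo := 0) (hi := B.gamma0Hi i v) (hbin i 1 mem_Icc_one)
      (le_max_left 0 (D.pi 1 v + D.lam - α 0 i.succ))
      (max_le (by linarith) (by linarith))
    rw [zero_mul, zero_mul, add_zero] at h3
    exact ⟨h3.2.1, h3.1, h3.2.2.1, h3.2.2.2⟩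
  · intro i j hj v hv
    have h0 := hB.deltaHi i j v
    have h1 := P1_bounds D hj hv
    have h2 := hρ i
    simp only [tightBounds] at h0
    have h3 := mccormick_of_eq (lo := 0) (hi := B.deltaHi i j v) (hbin i _ (mem_Icc_pred hj))
      (le_max_left 0 (D.pi j v - ρ i))
      (max_le (by linarith) (by linarith))
    rw [zero_mul, zero_mul, add_zero] at h3
    exact ⟨h3.2.1, h3.1, h3.2.2.2, h3.2.2.1⟩
  · exact fun i j hj => mccormick_of_eq (hbin i _ (mem_Icc_pred hj))
      ((hB.rhoLo i).trans (hρ i).1) ((hρ i).2.trans (hB.rhoHi i))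

/-- The sets of positions that cut the route into intervals. -/
abbrev Breaks (N : ℕ) : Type := {C : Finset ℕ // C ∈ (range (N + 2)).powerset}

/-- At every first-stage decision some feasible solution of the program is not worse than the
expected cost under some distribution of the ambiguity set. -/
theorem CostConditions.exists_solution_and_distribution {D : Data N} (hC : CostConditions D)
    (hD : SupportConditions D) (hlam : 0 ≤ D.lam) {B : Bounds N} (hB : B.Wider (tightBounds D))
    {x : Fin N → ℕ → ℝ} (hx : x ∈ routes N) {a : ℕ → ℝ} (ha : a ∈ schedules D) :
    ∃ z ∈ milpFeasibleSet D B, (∀ i j, z (.x i j) = x i j) ∧ (∀ j, z (.a j) = a j) ∧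
      ∃ P ∈ ambiguitySet D, milpObj D z ≤ ∫ s, recourse D x a s ∂P := by
  have hN := hC.pos
  have : Nonempty (Breaks N) := ⟨⟨∅, Finset.empty_mem_powerset _⟩⟩
  let c : Breaks N → Fin N ⊕ Arc N → ℝ := fun k => Sum.elim (serviceCoef x (dualSol D k.1))
    fun e => arcCoef D.lam x (dualSol D k.1) e.1.1 e.1.2
  let b : Breaks N → ℝ := fun k => scheduleTerm (N := N) a (dualSol D k.1)
  let lo : Fin N ⊕ Arc N → ℝ := Sum.elim D.dlo fun e => D.tlo e.1.1 e.1.2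
  let hi : Fin N ⊕ Arc N → ℝ := Sum.elim D.dhi fun e => D.thi e.1.1 e.1.2
  obtain ⟨θ, hθ, p, hp, hmean, hval⟩ := exists_multiplier_and_distribution c b
    (lo := lo) (hi := hi) (mean := Sum.elim D.meanD fun e => D.meanT e.1.1 e.1.2)
    (cl := Sum.elim (fun _ => D.P1l) fun e => arcMult D.lam x (alphaMin D) e.1.1 e.1.2)
    (ch := Sum.elim (fun _ => D.P1u) fun e => arcMult D.lam x (alphaMax D) e.1.1 e.1.2)
    (by rintro (i | e); exacts [(hD.service i).2.1, (hD.travel _ _ e.2).2.1])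
    (by rintro (i | e); exacts [(hD.service i).2.2, (hD.travel _ _ e.2).2.2])
    (by rintro k (i | e); exacts [serviceCoef_bounds D hx k.1 i, arcCoef_bounds D hx k.1 _ _])
  obtain ⟨α, hα, hαθ⟩ := exists_alpha hN D x (fun e => θ (.inr e)) fun e => hθ (.inr e)
  set ρ : Fin N → ℝ := fun i => θ (.inl i) with hρ
  have hfeas : MILPFeasible D B (solution D x a α ρ) :=
    solution_feasible hlam hB hx ha hα fun i => hθ (.inl i)
  let ξ : Breaks N × (Fin N ⊕ Arc N → Bool) → Scenario N := fun k =>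
    (fun i => vertex lo hi k.2 (.inl i), fun e => vertex lo hi k.2 (.inr e))
  have hξ : ∀ k, ξ k ∈ support D := by
    intro k
    constructor
    · intro i
      have h1 := hD.service i
      simp only [ξ, vertex, lo, hi, Sum.elim_inl]
      split_ifs <;> refine ⟨?_, ?_, ?_⟩ <;> linarith
    · intro e
      have h1 := hD.travel _ _ e.2
      simp only [ξ, vertex, lo, hi, Sum.elim_inr]
      split_ifs <;> refine ⟨?_, ?_, ?_⟩ <;> linarith
  refine ⟨solution D x a α ρ, hfeas, fun _ _ => rfl, fun _ => rfl, discrete p ξ,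
    discrete_mem_ambiguitySet hp hξ (fun i => hmean (.inl i)) (fun e => hmean (.inr e)), ?_⟩
  rw [integral_discrete hp.1, milpObj_eq hN D (exactProducts_solution D x a α ρ) hx.2.2.2]
  -- The potentials telescope to the value of a best partition, which is then one of the indices `k`
  -- in `hval`.
  have hsum : ∑ j ∈ Icc 1 (N + 2), solution D x a α ρ (.beta j)
      = bestPartition (stageValue D x a α ρ) (N + 2) := by
    have := sum_bestPartition_increments (stageValue D x a α ρ) (k := 1) (v := N + 2) le_rfl
      (by omega)
    rw [Nat.sub_self, bestPartition_zero, sub_zero] at this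
    exact this
  obtain ⟨C, hCs, hbest⟩ := exists_partitionValue_eq_best (stageValue D x a α ρ) (N + 2)
  rw [hsum, hbest, partitionValue_stageValue hN D hx]
  refine le_trans (le_of_eq ?_) ((hval ⟨C, Finset.mem_powerset.2 hCs⟩).trans
    (Finset.sum_le_sum fun k _ => mul_le_mul_of_nonneg_left ?_ (hp.1 k)))
  · simp only [Fintype.sum_sum_type, Finset.sum_add_distrib, c, b, lo, hi, Sum.elim_inl,
      Sum.elim_inr, ← hαθ, hρ]
    simp only [solution]
    ring
  -- At each atom the weight comes with its own partition, whose dual value is at most the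
  -- second-stage cost there.
  · refine le_trans (le_of_eq ?_) (hC.cutValue_le_recourse hx a (ξ k) k.1.1)
    rw [cutValue_eq hN D hx, Fintype.sum_sum_type]
    rfl

/-! ### Affine forms and polyhedral conditions in finitely many variables -/

/-- `f` is an affine function of finitely many variables. -/
def IsAffineForm {V : Type} (f : (V → ℝ) → ℝ) : Prop :=
  ∃ (c : V →₀ ℝ) (b : ℝ), ∀ z, f z = (c.sum fun v r => r * z v) + b

/-- `P` is a conjunction of finitely many linear inequalities. -/
def IsPolyhedral {V : Type} (P : (V → ℝ) → Prop) : Prop :=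
  ∃ C : Set ((V →₀ ℝ) × ℝ), C.Finite ∧
    ∀ z, P z ↔ ∀ p ∈ C, (p.1.sum fun v r => r * z v) ≤ p.2

theorem finsupp_sum_add {V : Type} (c d : V →₀ ℝ) (z : V → ℝ) :
    ((c + d).sum fun v r => r * z v) = (c.sum fun v r => r * z v) + d.sum fun v r => r * z v :=
  Finsupp.sum_add_index' (fun _ => zero_mul _) fun _ _ _ => add_mul _ _ _

theorem finsupp_sum_smul {V : Type} (t : ℝ) (c : V →₀ ℝ) (z : V → ℝ) :
    ((t • c).sum fun v r => r * z v) = t * c.sum fun v r => r * z v := by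
  rw [Finsupp.sum_smul_index fun _ => zero_mul _, Finsupp.mul_sum]
  simp_rw [mul_assoc]

namespace IsAffineForm

variable {V : Type} {f g : (V → ℝ) → ℝ}

theorem var (v : V) : IsAffineForm fun z : V → ℝ => z v :=
  ⟨Finsupp.single v 1, 0, fun z => by simp⟩

theorem const (b : ℝ) : IsAffineForm fun _ : V → ℝ => b := ⟨0, b, fun z => by simp⟩

theorem add (hf : IsAffineForm f) (hg : IsAffineForm g) : IsAffineForm fun z => f z + g z := by
  obtain ⟨c, b, h⟩ := hf
  obtain ⟨c', b', h'⟩ := hg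
  refine ⟨c + c', b + b', fun z => ?_⟩
  beta_reduce
  rw [h, h', finsupp_sum_add]
  ring

theorem const_mul (t : ℝ) (hf : IsAffineForm f) : IsAffineForm fun z => t * f z := by
  obtain ⟨c, b, h⟩ := hf
  refine ⟨t • c, t * b, fun z => ?_⟩
  beta_reduce
  rw [h, finsupp_sum_smul]
  ring

theorem mul_const (hf : IsAffineForm f) (t : ℝ) : IsAffineForm fun z => f z * t := by
  simpa only [mul_comm] using hf.const_mul t

theorem neg (hf : IsAffineForm f) : IsAffineForm fun z => -f z := by
  simpa using hf.const_mul (-1)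

theorem sub (hf : IsAffineForm f) (hg : IsAffineForm g) : IsAffineForm fun z => f z - g z := by
  simpa only [sub_eq_add_neg] using hf.add hg.neg

theorem sum {ι : Type*} (s : Finset ι) {F : ι → (V → ℝ) → ℝ} (h : ∀ i ∈ s, IsAffineForm (F i)) :
    IsAffineForm fun z => ∑ i ∈ s, F i z := by
  classical
  induction s using Finset.induction_on with
  | empty => simpa using const 0
  | insert i s hi ih =>
    simp_rw [Finset.sum_insert hi]
    exact (h i (by simp)).add (ih fun j hj => h j (by simp [hj]))

theorem exists_linear (hf : IsAffineForm f) (h0 : f 0 = 0) :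
    ∃ c : V →₀ ℝ, ∀ z, f z = c.sum fun v r => r * z v := by
  obtain ⟨c, b, h⟩ := hf
  have hb : b = 0 := by
    have := h 0
    rw [h0] at this
    simpa [Finsupp.sum] using this.symm
  exact ⟨c, fun z => by rw [h, hb, add_zero]⟩

end IsAffineForm

namespace IsPolyhedral

variable {V : Type}

theorem le {f g : (V → ℝ) → ℝ} (hf : IsAffineForm f) (hg : IsAffineForm g) :
    IsPolyhedral fun z => f z ≤ g z := by
  obtain ⟨c, b, h⟩ := hf.sub hg
  refine ⟨{(c, -b)}, Set.finite_singleton _, fun z => ?_⟩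
  have := h z
  simp only [Set.mem_singleton_iff, forall_eq]
  constructor <;> intro h1 <;> linarith

theorem and {P Q : (V → ℝ) → Prop} (hP : IsPolyhedral P) (hQ : IsPolyhedral Q) :
    IsPolyhedral fun z => P z ∧ Q z := by
  obtain ⟨C, hC, h⟩ := hP
  obtain ⟨C', hC', h'⟩ := hQ
  refine ⟨C ∪ C', hC.union hC', fun z => ?_⟩
  simp only [h, h', Set.mem_union, or_imp, forall_and]

theorem eq {f g : (V → ℝ) → ℝ} (hf : IsAffineForm f) (hg : IsAffineForm g) :
    IsPolyhedral fun z => f z = g z := by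
  simpa only [le_antisymm_iff] using (le hf hg).and (le hg hf)

theorem forall_mem {ι : Type*} (s : Finset ι) {P : ι → (V → ℝ) → Prop}
    (h : ∀ i ∈ s, IsPolyhedral (P i)) : IsPolyhedral fun z => ∀ i ∈ s, P i z := by
  classical
  induction s using Finset.induction_on with
  | empty => exact ⟨∅, Set.finite_empty, by simp⟩
  | insert i s hi ih =>
    simp_rw [Finset.forall_mem_insert]
    exact (h i (by simp)).and (ih fun j hj => h j (by simp [hj]))

theorem forall_fintype {ι : Type*} [Fintype ι] {P : ι → (V → ℝ) → Prop}
    (h : ∀ i, IsPolyhedral (P i)) : IsPolyhedral fun z => ∀ i, P i z := by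
  simpa using forall_mem univ fun i _ => h i

end IsPolyhedral

/-! ### The reformulation is a mixed-integer linear program -/

theorem isAffineForm_startTerm (D : Data N) (v : ℕ) :
    IsAffineForm fun z => startTerm D z v := by
  unfold startTerm
  repeat' first
    | exact .var _
    | refine IsAffineForm.sum _ fun _ _ => ?_
    | apply IsAffineForm.sub
    | apply IsAffineForm.add
    | apply IsAffineForm.neg
    | apply IsAffineForm.const_mul
    | apply IsAffineForm.mul_const

theorem isAffineForm_blockTerm (D : Data N) (k v : ℕ) :
    IsAffineForm fun z => blockTerm D z k v := by
  unfold blockTerm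
  repeat' first
    | exact .var _
    | refine IsAffineForm.sum _ fun _ _ => ?_
    | apply IsAffineForm.sub
    | apply IsAffineForm.add
    | apply IsAffineForm.const_mul
    | apply IsAffineForm.mul_const

theorem isAffineForm_milpObj (D : Data N) : IsAffineForm (milpObj D) := by
  unfold milpObj
  repeat' first
    | exact .var _
    | refine IsAffineForm.sum _ fun _ _ => ?_
    | apply IsAffineForm.add
    | apply IsAffineForm.const_mul

theorem isPolyhedral_assignment :
    IsPolyhedral fun z : Var N → ℝ => (∀ j ∈ Icc 1 N, ∑ i, z (.x i j) = 1) ∧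
      (∀ i, ∑ j ∈ Icc 1 N, z (.x i j) = 1) ∧ ∀ i, z (.x i (N + 1)) = 0 := by
  refine .and (.forall_mem _ fun _ _ => ?_) (.and (.forall_fintype fun _ => ?_)
    (.forall_fintype fun _ => .eq (.var _) (.const _))) <;>
    exact .eq (.sum _ fun _ _ => .var _) (.const _)

theorem isPolyhedral_schedule (D : Data N) :
    IsPolyhedral fun z : Var N → ℝ => (fun j => z (.a j)) ∈ schedules D :=
  .and (.forall_mem _ fun _ _ => .and (.le (.const _) (.var _)) (.le (.var _) (.const _)))
    (.and (.forall_mem _ fun _ _ => .le (.var _) (.var _)) (.eq (.var _) (.const _)))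

/-- Only the binary conditions inside `routes` are not linear; they are split off and the rest is
assembled from affine inequalities. -/
theorem exists_linear_constraints (D : Data N) (B : Bounds N) :
    ∃ Q : (Var N → ℝ) → Prop, IsPolyhedral Q ∧ ∀ z, MILPFeasible D B z ↔
      (∀ i, ∀ j ∈ Icc 1 N, z (.x i j) = 0 ∨ z (.x i j) = 1) ∧ Q z := by
  refine ⟨fun z => ((∀ j ∈ Icc 1 N, ∑ i, z (.x i j) = 1) ∧
      (∀ i, ∑ j ∈ Icc 1 N, z (.x i j) = 1) ∧ ∀ i, z (.x i (N + 1)) = 0) ∧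
      (fun j => z (.a j)) ∈ schedules D ∧
      _ ∧ _ ∧ _ ∧ _ ∧ _ ∧ _ ∧ _ ∧ _ ∧ _ ∧ _ ∧ _ ∧ _ ∧ _ ∧ _, ?_, fun z =>
      ⟨fun h => ⟨h.route.2.2.1, ⟨h.route.1, h.route.2.1, h.route.2.2.2⟩, h.schedule,
        h.beta_first, h.beta_start, h.beta_block, h.beta_last, h.gamma0_ge, h.gamma_ge,
        h.delta_ge, h.mc_tau, h.mc_eta, h.mc_psi, h.mc_phi, h.mc_sigma, h.mc_xi, h.mc_zeta⟩,
      fun ⟨hb, ⟨h1, h2, h3⟩, h4, h5, h6, h7, h8, h9, h10, h11, h12, h13, h14, h15, h16, h17, h18⟩ =>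
        ⟨⟨h1, h2, hb, h3⟩, h4, h5, h6, h7, h8, h9, h10, h11, h12, h13, h14, h15, h16, h17, h18⟩⟩⟩
  refine .and isPolyhedral_assignment (.and (isPolyhedral_schedule D) ?_)
  repeat' first
    | exact isAffineForm_startTerm D _
    | exact isAffineForm_blockTerm D _ _
    | exact .var _
    | exact .const _
    | apply IsPolyhedral.and
    | refine IsPolyhedral.forall_mem _ fun _ _ => ?_
    | refine IsPolyhedral.forall_fintype fun _ => ?_
    | apply IsPolyhedral.le
    | refine IsAffineForm.sum _ fun _ _ => ?_
    | apply IsAffineForm.sub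
    | apply IsAffineForm.add
    | apply IsAffineForm.const_mul

theorem finite_binaryVars (N : ℕ) : (binaryVars N).Finite := by
  refine ((univ ×ˢ Icc 1 N).finite_toSet.image fun q : Fin N × ℕ => Var.x q.1 q.2).subset ?_
  rintro _ ⟨i, j, hj, rfl⟩
  exact ⟨(i, j), by simpa using hj, rfl⟩

theorem isMILP (D : Data N) (B : Bounds N) :
    IsMILP (binaryVars N) (milpObj D) (milpFeasibleSet D B) := by
  obtain ⟨Q, ⟨C, hC, hQ⟩, h⟩ := exists_linear_constraints D B
  refine ⟨finite_binaryVars N, (isAffineForm_milpObj D).exists_linear (by simp [milpObj]),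
    C, hC, ?_⟩
  ext z
  refine (h z).trans (and_congr ?_ (hQ z))
  constructor
  · rintro h1 _ ⟨i, j, hj, rfl⟩
    exact h1 i j hj
  · exact fun h1 i j hj => h1 _ ⟨i, j, hj, rfl⟩

/-! ### The worst-case expected cost -/

/-- The constructed pair does both jobs: its distribution shows that the set of costs is nonempty,
its feasible point bounds the set from above. -/
theorem isLUB_worstCase {D : Data N} (hC : CostConditions D) (hD : SupportConditions D)
    (hlam : 0 ≤ D.lam) {x : Fin N → ℕ → ℝ} (hx : x ∈ routes N) {a : ℕ → ℝ}
    (ha : a ∈ schedules D) {B : Bounds N} (hB : B.Wider (tightBounds D)) :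
    IsLUB (expectedCosts D x a) (worstCase D x a) := by
  obtain ⟨z, hz, hzx, hza, P, hP, -⟩ := hC.exists_solution_and_distribution hD hlam hB hx ha
  refine isLUB_csSup ⟨_, P, hP, rfl⟩ ⟨milpObj D z, ?_⟩
  rintro _ ⟨P', hP', rfl⟩
  have := hC.integral_recourse_le hD hz hP'
  simpa only [hzx, hza] using this

theorem worstCase_le_milpObj {D : Data N} (hC : CostConditions D) (hD : SupportConditions D)
    (hlam : 0 ≤ D.lam) {B : Bounds N} (hB : B.Wider (tightBounds D)) {z : Var N → ℝ}
    (hz : z ∈ milpFeasibleSet D B) :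
    worstCase D (fun i j => z (.x i j)) (fun j => z (.a j)) ≤ milpObj D z := by
  refine (isLUB_worstCase hC hD hlam hz.route hz.schedule hB).2 ?_
  rintro _ ⟨P, hP, rfl⟩
  exact hC.integral_recourse_le hD hz hP

theorem isLeast_worstCase {D : Data N} (hC : CostConditions D) (hD : SupportConditions D)
    (hlam : 0 ≤ D.lam) {B : Bounds N} (hB : B.Wider (tightBounds D)) {x : Fin N → ℕ → ℝ}
    (hx : x ∈ routes N) {a : ℕ → ℝ} (ha : a ∈ schedules D) :
    IsLeast {r | ∃ z ∈ milpFeasibleSet D B,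
      (∀ i j, z (.x i j) = x i j) ∧ (∀ j, z (.a j) = a j) ∧ r = milpObj D z}
      (worstCase D x a) := by
  have hle : ∀ z ∈ milpFeasibleSet D B, (∀ i j, z (.x i j) = x i j) → (∀ j, z (.a j) = a j) →
      worstCase D x a ≤ milpObj D z := by
    intro z hz hzx hza
    simpa only [hzx, hza] using worstCase_le_milpObj hC hD hlam hB hz
  constructor
  · obtain ⟨z, hz, hzx, hza, P, hP, h⟩ := hC.exists_solution_and_distribution hD hlam hB hx ha
    exact ⟨z, hz, hzx, hza, le_antisymm (hle z hz hzx hza)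
      (h.trans ((isLUB_worstCase hC hD hlam hx ha hB).1 ⟨P, hP, rfl⟩))⟩
  · rintro _ ⟨z, hz, hzx, hza, rfl⟩
    exact hle z hz hzx hza

/-! ### Dependence on the first-stage decision -/

/-- A modulus of continuity for the costs as functions of the schedule. -/
def scheduleGap (D : Data N) (a a' : ℕ → ℝ) : ℝ :=
  ∑ B ∈ (range (N + 2)).powerset,
    |scheduleTerm (N := N) a (dualSol D B) - scheduleTerm (N := N) a' (dualSol D B)|

theorem scheduleGap_comm (D : Data N) (a a' : ℕ → ℝ) :
    scheduleGap D a a' = scheduleGap D a' a :=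
  Finset.sum_congr rfl fun _ _ => abs_sub_comm _ _

/-- The schedule enters each dual value only through `scheduleTerm`, so the error is uniform in the
scenario and survives integration. -/
theorem CostConditions.recourse_le_add {D : Data N} (hC : CostConditions D)
    {x : Fin N → ℕ → ℝ} (hx : x ∈ routes N) (a a' : ℕ → ℝ) (s : Scenario N) :
    recourse D x a s ≤ recourse D x a' s + scheduleGap D a a' := by
  obtain ⟨B, hB, he, -⟩ := hC.exists_recourse_eq hx a s
  have h1 := hC.cutValue_le_recourse hx a' s B
  have h2 : |scheduleTerm (N := N) a (dualSol D B) - scheduleTerm (N := N) a' (dualSol D B)|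
      ≤ scheduleGap D a a' :=
    Finset.single_le_sum (f := fun B => |scheduleTerm (N := N) a (dualSol D B)
      - scheduleTerm (N := N) a' (dualSol D B)|) (fun _ _ => abs_nonneg _)
      (Finset.mem_powerset.2 hB)
  have h3 := (le_abs_self _).trans h2
  rw [cutValue_eq hC.pos D hx] at h1
  rw [he, cutValue_eq hC.pos D hx]
  linarith

theorem worstCase_le_add {D : Data N} (hC : CostConditions D) (hD : SupportConditions D)
    (hlam : 0 ≤ D.lam) {x : Fin N → ℕ → ℝ} (hx : x ∈ routes N) {a a' : ℕ → ℝ}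
    (ha : a ∈ schedules D) (ha' : a' ∈ schedules D) {B : Bounds N}
    (hB : B.Wider (tightBounds D)) :
    worstCase D x a ≤ worstCase D x a' + scheduleGap D a a' := by
  refine (isLUB_worstCase hC hD hlam hx ha hB).2 ?_
  rintro _ ⟨P, hP, rfl⟩
  have := hP.1
  have h1 : ∫ s, recourse D x a s ∂P ≤ ∫ s, (recourse D x a' s + scheduleGap D a a') ∂P :=
    integral_mono (hC.integrable_recourse hx a hP)
      ((hC.integrable_recourse hx a' hP).add (integrable_const _))
      fun s => hC.recourse_le_add hx a a' s
  rw [integral_add (hC.integrable_recourse hx a' hP) (integrable_const _)] at h1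
  have h2 := (isLUB_worstCase hC hD hlam hx ha' hB).1 ⟨P, hP, rfl⟩
  simp only [integral_const, probReal_univ, one_smul] at h1
  exact h1.trans (add_le_add h2 le_rfl)

theorem continuousOn_worstCase {D : Data N} (hC : CostConditions D) (hD : SupportConditions D)
    (hlam : 0 ≤ D.lam) {x : Fin N → ℕ → ℝ} (hx : x ∈ routes N) {B : Bounds N}
    (hB : B.Wider (tightBounds D)) : ContinuousOn (worstCase D x) (schedules D) := by
  intro a ha
  have hcont : Continuous fun a' => scheduleGap D a' a := by
    unfold scheduleGap scheduleTerm
    fun_prop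
  have hlim : Filter.Tendsto (fun a' => scheduleGap D a' a) (nhdsWithin a (schedules D))
      (nhds 0) := by
    have := (hcont.tendsto a).mono_left (nhdsWithin_le_nhds (s := schedules D))
    simpa [scheduleGap] using this
  rw [ContinuousWithinAt, tendsto_iff_dist_tendsto_zero]
  refine squeeze_zero' (Filter.Eventually.of_forall fun _ => dist_nonneg) ?_ hlim
  filter_upwards [self_mem_nhdsWithin] with a' ha'
  rw [Real.dist_eq, abs_sub_le_iff]
  have h1 := worstCase_le_add hC hD hlam hx ha' ha hB
  have h2 := worstCase_le_add hC hD hlam hx ha ha' hB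
  rw [scheduleGap_comm D a a'] at h2
  constructor <;> linarith

/-- Schedules are functions on `ℕ` with coordinates outside `1, …, N + 1` unconstrained, so
compactness requires cutting with a cube. -/
theorem isCompact_bounded_schedules (D : Data N) :
    IsCompact (Set.pi Set.univ (fun _ : ℕ => Set.Icc 0 D.L) ∩ schedules D) := by
  refine (isCompact_univ_pi fun _ => isCompact_Icc).inter_right ?_
  have : schedules D = (⋂ j ∈ Icc 1 N, {a : ℕ → ℝ | 0 ≤ a j} ∩ {a | a j ≤ D.L}) ∩
      ((⋂ j ∈ Icc 2 N, {a : ℕ → ℝ | a (j - 1) ≤ a j}) ∩ {a | a (N + 1) = D.L}) := by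
    ext a
    simp [schedules]
  rw [this]
  refine (isClosed_biInter fun j _ => ?_).inter ((isClosed_biInter fun j _ => ?_).inter ?_)
  · exact (isClosed_le continuous_const (continuous_apply j)).inter
      (isClosed_le (continuous_apply j) continuous_const)
  · exact isClosed_le (continuous_apply _) (continuous_apply j)
  · exact isClosed_eq (continuous_apply _) continuous_const

theorem exists_best_schedule {D : Data N} (hC : CostConditions D) (hD : SupportConditions D)
    (hlam : 0 ≤ D.lam) (hL : 0 ≤ D.L) {x : Fin N → ℕ → ℝ} (hx : x ∈ routes N) {B : Bounds N}
    (hB : B.Wider (tightBounds D)) :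
    ∃ a ∈ schedules D, ∀ a' ∈ schedules D, worstCase D x a ≤ worstCase D x a' := by
  obtain ⟨a, ha, hmin⟩ := (isCompact_bounded_schedules D).exists_isMinOn
    ⟨fun _ => D.L, fun _ _ => ⟨hL, le_rfl⟩, fun _ _ => ⟨hL, le_rfl⟩, fun _ _ => le_rfl, rfl⟩
    ((continuousOn_worstCase hC hD hlam hx hB).mono Set.inter_subset_right)
  refine ⟨a, ha.2, fun a' ha' => ?_⟩
  -- Truncation moves an arbitrary schedule into the cube without changing its cost, as only the
  -- positions `1, …, N + 1` enter.
  set a'' : ℕ → ℝ := fun j => if j ∈ Icc 1 (N + 1) then a' j else 0 with ha''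
  have heq : ∀ j ∈ Icc 1 (N + 1), a'' j = a' j := fun j hj => if_pos hj
  have hmem : a'' ∈ schedules D := by
    refine ⟨fun j hj => ?_, fun j hj => ?_, ?_⟩
    · rw [heq j (Finset.Icc_subset_Icc_right (by omega) hj)]
      exact ha'.1 j hj
    · rw [heq j (by rw [Finset.mem_Icc] at hj ⊢; omega),
        heq (j - 1) (by rw [Finset.mem_Icc] at hj ⊢; omega)]
      exact ha'.2.1 j hj
    · rw [heq _ (by simp)]
      exact ha'.2.2
  have hbox : a'' ∈ Set.pi Set.univ (fun _ : ℕ => Set.Icc 0 D.L) := by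
    intro j _
    by_cases hj : j ∈ Icc 1 (N + 1)
    · rw [heq j hj]
      obtain ⟨h1, h2⟩ := Finset.mem_Icc.1 hj
      rcases h2.lt_or_eq with h3 | rfl
      · exact ha'.1 j (Finset.mem_Icc.2 ⟨h1, by omega⟩)
      · rw [ha'.2.2]
        exact ⟨hL, le_rfl⟩
    · simp only [ha'', if_neg hj]
      exact ⟨le_rfl, hL⟩
  have hgap : scheduleGap D a'' a' = 0 := by
    refine Finset.sum_eq_zero fun C _ => ?_
    have : scheduleTerm (N := N) a'' (dualSol D C) = scheduleTerm (N := N) a' (dualSol D C) := by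
      unfold scheduleTerm
      rw [heq 1 mem_Icc_one]
      congr 1
      refine Finset.sum_congr rfl fun j hj => ?_
      rw [heq j (mem_Icc_of_two hj), heq _ (mem_Icc_pred hj)]
    rw [this, sub_self, abs_zero]
  have h1 : worstCase D x a ≤ worstCase D x a'' := hmin ⟨hbox, hmem⟩
  have h2 := worstCase_le_add hC hD hlam hx hmem ha' hB
  rw [hgap, add_zero] at h2
  exact h1.trans h2

theorem CostConditions.recourse_congr_route {D : Data N} (hC : CostConditions D)
    {x x' : Fin N → ℕ → ℝ} (hx : x ∈ routes N) (hx' : x' ∈ routes N)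
    (h : ∀ i, ∀ j ∈ Icc 1 (N + 1), x i j = x' i j) (a : ℕ → ℝ) :
    recourse D x a = recourse D x' a := by
  have hN := hC.pos
  have h1 : ∀ B, serviceCoef x (dualSol D B) = serviceCoef x' (dualSol D B) := by
    intro B
    ext i
    refine Finset.sum_congr rfl fun j hj => ?_
    rw [h i _ (mem_Icc_pred hj)]
  have h2 : ∀ B, arcCoef D.lam x (dualSol D B) = arcCoef D.lam x' (dualSol D B) := by
    intro B
    ext p q
    refine Fin.cases ?_ (fun i => ?_) p <;> refine Fin.cases ?_ (fun i' => ?_) q <;>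
      simp only [arcCoef, Fin.cases_zero, Fin.cases_succ]
    · rw [h i' 1 mem_Icc_one]
    · rw [h i N (Finset.mem_Icc.2 ⟨hN, by omega⟩)]
    · refine Finset.sum_congr rfl fun j hj => ?_
      rw [h i _ (mem_Icc_pred hj), h i' j (mem_Icc_of_two hj)]
  rw [hC.recourse_eq_sup' hx, hC.recourse_eq_sup' hx']
  congr 1
  ext B s
  rw [cutValue_eq hN D hx, cutValue_eq hN D hx', h1, h2]

theorem CostConditions.worstCase_congr_route {D : Data N} (hC : CostConditions D)
    {x x' : Fin N → ℕ → ℝ} (hx : x ∈ routes N) (hx' : x' ∈ routes N)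
    (h : ∀ i, ∀ j ∈ Icc 1 (N + 1), x i j = x' i j) (a : ℕ → ℝ) :
    worstCase D x a = worstCase D x' a := by
  rw [worstCase, worstCase, expectedCosts, expectedCosts, hC.recourse_congr_route hx hx' h]

/-- The route that serves customer `i` at position `p i`. -/
def routeOf (p : Fin N → Fin (N + 1)) (i : Fin N) (j : ℕ) : ℝ := if j = p i then 1 else 0

theorem routeOf_succ_mem : routeOf (Fin.succ (n := N)) ∈ routes N := by
  refine ⟨fun j hj => ?_, fun i => ?_, fun i j _ => ?_, fun i => ?_⟩
  · obtain ⟨h1, h2⟩ := Finset.mem_Icc.1 hj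
    rw [Finset.sum_eq_single (⟨j - 1, by omega⟩ : Fin N)]
    · exact if_pos (by simp only [Fin.val_succ]; omega)
    · intro i _ hi
      refine if_neg fun h => hi (Fin.ext ?_)
      simp only [Fin.val_succ] at h
      simp only
      omega
    · simp
  · simp only [routeOf, Fin.val_succ, Finset.sum_ite_eq']
    exact if_pos (Finset.mem_Icc.2 ⟨by omega, i.2⟩)
  · unfold routeOf
    split_ifs <;> simp
  · refine if_neg fun h => ?_
    have := i.2
    simp only [Fin.val_succ] at h
    omega

/-- Reduces the route to one of finitely many representatives, indexed by the maps `Fin N → Fin (N +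
1)`; values outside the positions `1, …, N + 1` do not affect the cost. -/
theorem exists_routeOf_eq {x : Fin N → ℕ → ℝ} (hx : x ∈ routes N) :
    ∃ p, routeOf p ∈ routes N ∧ ∀ i, ∀ j ∈ Icc 1 (N + 1), x i j = routeOf p i j := by
  choose p hp hxp using exists_position hx
  have key : ∀ i, ∀ j ∈ Icc 1 (N + 1), x i j = routeOf
      (fun i => ⟨p i, by have := (Finset.mem_Icc.1 (hp i)).2; omega⟩ : Fin N → Fin (N + 1)) i j := by
    intro i j hj
    obtain ⟨h1, h2⟩ := Finset.mem_Icc.1 hj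
    rcases h2.lt_or_eq with h3 | rfl
    · exact hxp i j (Finset.mem_Icc.2 ⟨h1, by omega⟩)
    · have := (Finset.mem_Icc.1 (hp i)).2
      rw [hx.2.2.2 i, routeOf, if_neg]
      simp only
      omega
  refine ⟨_, ⟨fun j hj => ?_, fun i => ?_, fun i j hj => ?_, fun i => ?_⟩, key⟩
  · rw [← hx.1 j hj]
    exact Finset.sum_congr rfl fun i _ =>
      (key i j (Finset.Icc_subset_Icc_right (by omega) hj)).symm
  · rw [← hx.2.1 i]
    exact Finset.sum_congr rfl fun j hj =>
      (key i j (Finset.Icc_subset_Icc_right (by omega) hj)).symm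
  · rw [← key i j (Finset.Icc_subset_Icc_right (by omega) hj)]
    exact hx.2.2.1 i j hj
  · rw [← key i _ (by simp)]
    exact hx.2.2.2 i

theorem exists_isOptimalDRO {D : Data N} (hC : CostConditions D) (hD : SupportConditions D)
    (hlam : 0 ≤ D.lam) (hL : 0 ≤ D.L) {B : Bounds N} (hB : B.Wider (tightBounds D)) :
    ∃ x a, IsOptimalDRO D x a := by
  have hbest : ∀ p : Fin N → Fin (N + 1), ∃ a, routeOf p ∈ routes N →
      a ∈ schedules D ∧ ∀ a' ∈ schedules D, worstCase D (routeOf p) a ≤ worstCase D (routeOf p) a' := by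
    intro p
    by_cases hp : routeOf p ∈ routes N
    · obtain ⟨a, ha, h⟩ := exists_best_schedule hC hD hlam hL hp hB
      exact ⟨a, fun _ => ⟨ha, h⟩⟩
    · exact ⟨0, fun h => absurd h hp⟩
  choose a ha using hbest
  -- Each representative route already has a best schedule, so a finite minimum remains; serving the
  -- customers in their given order shows that there is a route.
  obtain ⟨p, hp, hmin⟩ := Set.exists_min_image {p | routeOf p ∈ routes N}
    (fun p => worstCase D (routeOf p) (a p)) (Set.toFinite _) ⟨_, routeOf_succ_mem⟩
  refine ⟨routeOf p, a p, hp, (ha p hp).1, fun x' hx' a' ha' => ?_⟩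
  obtain ⟨p', hp', h⟩ := exists_routeOf_eq hx'
  rw [hC.worstCase_congr_route hx' hp' h]
  exact (hmin p' hp').trans ((ha p' hp').2 a' ha')

end DHRAS

end

theorem mainTheorem1 {N : ℕ} (hN : 1 ≤ N) (D : DHRAS.Data N)
    (hL : 0 ≤ D.L)
    (hcw : ∀ j ∈ Finset.Icc 1 N, 0 ≤ D.cw j)
    (hcu : ∀ j ∈ Finset.Icc 1 N, 0 ≤ D.cu j)
    (hco : 0 ≤ D.co) (hlam : 0 ≤ D.lam)
    (hcost : ∀ j, 1 ≤ j → j + 1 ≤ N → D.cu (j + 1) ≤ D.cu j + D.cw j)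
    (hd : ∀ i, 0 ≤ D.dlo i ∧ D.dlo i ≤ D.meanD i ∧ D.meanD i ≤ D.dhi i)
    (ht : ∀ p q, p ≠ q → 0 ≤ D.tlo p q ∧ D.tlo p q ≤ D.meanT p q ∧ D.meanT p q ≤ D.thi p q)
    (B : DHRAS.Bounds N) (hB : B.Wider (DHRAS.tightBounds D)) :
    -- the reformulation is a mixed-integer linear program
    DHRAS.IsMILP (DHRAS.binaryVars N) (DHRAS.milpObj D) (DHRAS.milpFeasibleSet D B) ∧
    -- M-DHRAS is well posed: the second-stage minimum is attained, the expectations exist,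
    -- and the supremum over the ambiguity set is a finite one over a nonempty set
    (∀ x ∈ DHRAS.routes N, ∀ a ∈ DHRAS.schedules D,
      (∀ s ∈ DHRAS.support D,
        IsLeast (DHRAS.recourseValues D x a s) (DHRAS.recourse D x a s)) ∧
      (∀ P ∈ DHRAS.ambiguitySet D, MeasureTheory.Integrable (DHRAS.recourse D x a) P) ∧
      IsLUB (DHRAS.expectedCosts D x a) (DHRAS.worstCase D x a)) ∧
    -- at every first-stage decision the program has the worst-case expected cost as its minimum
    (∀ x ∈ DHRAS.routes N, ∀ a ∈ DHRAS.schedules D,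
      IsLeast {r | ∃ z ∈ DHRAS.milpFeasibleSet D B,
          (∀ i j, z (.x i j) = x i j) ∧ (∀ j, z (.a j) = a j) ∧ r = DHRAS.milpObj D z}
        (DHRAS.worstCase D x a)) ∧
    -- both problems attain their minima, and the optimal values agree
    (∃ Z : ℝ,
      IsLeast {r | ∃ x ∈ DHRAS.routes N, ∃ a ∈ DHRAS.schedules D, r = DHRAS.worstCase D x a} Z ∧
      IsLeast {r | ∃ z ∈ DHRAS.milpFeasibleSet D B, r = DHRAS.milpObj D z} Z) ∧
    -- the optimal first-stage decisions agree
    (∀ x a, DHRAS.IsOptimalDRO D x a ↔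
      ∃ z, DHRAS.IsOptimalMILP D B z ∧
        (∀ i j, z (.x i j) = x i j) ∧ ∀ j, z (.a j) = a j) := by
  have hC : DHRAS.CostConditions D := ⟨hN, hcw, hcu, hco, hcost⟩
  have hD : DHRAS.SupportConditions D := ⟨hd, ht⟩
  have hleast := fun x hx a ha => DHRAS.isLeast_worstCase hC hD hlam hB (x := x) hx (a := a) ha
  refine ⟨DHRAS.isMILP D B, fun x hx a ha => ⟨fun s _ => ?_,
    fun P hP => hC.integrable_recourse hx a hP, DHRAS.isLUB_worstCase hC hD hlam hx ha hB⟩,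
    hleast, ?_, fun x a => ⟨?_, ?_⟩⟩
  · obtain ⟨_, _, _, h⟩ := hC.exists_recourse_eq hx a s
    exact h
  · obtain ⟨x, a, hx, ha, hopt⟩ := DHRAS.exists_isOptimalDRO hC hD hlam hL hB
    refine ⟨DHRAS.worstCase D x a, ⟨⟨x, hx, a, ha, rfl⟩, ?_⟩, ?_, ?_⟩
    · rintro _ ⟨x', hx', a', ha', rfl⟩
      exact hopt x' hx' a' ha'
    · obtain ⟨z, hz, -, -, h⟩ := (hleast x hx a ha).1
      exact ⟨z, hz, h⟩
    · rintro _ ⟨z, hz, rfl⟩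
      exact (hopt _ hz.route _ hz.schedule).trans (DHRAS.worstCase_le_milpObj hC hD hlam hB hz)
  · rintro ⟨hx, ha, hopt⟩
    obtain ⟨z, hz, hzx, hza, h⟩ := (hleast x hx a ha).1
    refine ⟨z, ⟨hz, fun z' hz' => ?_⟩, hzx, hza⟩
    rw [← h]
    exact (hopt _ hz'.route _ hz'.schedule).trans (DHRAS.worstCase_le_milpObj hC hD hlam hB hz')
  · rintro ⟨z, ⟨hz, hopt⟩, hzx, hza⟩
    obtain rfl : (fun i j => z (.x i j)) = x := funext fun i => funext fun j => hzx i j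
    obtain rfl : (fun j => z (.a j)) = a := funext hza
    refine ⟨hz.route, hz.schedule, fun x' hx' a' ha' => ?_⟩
    obtain ⟨z', hz', -, -, h⟩ := (hleast x' hx' a' ha').1
    rw [h]
    exact (DHRAS.worstCase_le_milpObj hC hD hlam hB hz).trans (hopt z' hz')
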